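/- Let $\mathcal N=\{1,\dots,n\}$ be a set of products, let an assortment be a nonempty subset of $\mathcal N$, and let $\mathcal S$ be a collection of assortments. A choice probability collection over $\mathcal S$ is a vector $p=(p_{i,S}: S\in\mathcal S,\ i\in S)$ with $p_{i,S}\ge 0$ and $\sum_{i\in S}p_{i,S}=1$ for every $S\in\mathcal S$. It is a point of the finite-dimensional real space indexed by the pairs $(i,S)$ with $S\in\mathcal S$, $i\in S$, and closures are taken there. The utility of product $i$ is $\nu_i+\tilde\epsilon_i$, with $\nu\in\mathbb R^n$ deterministic and $\tilde\epsilon$ a random vector in $\mathbb R^n$. - $\mathcal P_{\rm RUM}(\mathcal S)$ is the set of $p$ for which there are $\nu\in\mathbb R^n$ and a probability law $\theta$ of $\tilde\epsilon$, under which $\nu_i+\tilde\epsilon_i=\nu_j+\tilde\epsilon_j$ has probability $0$ for all $i\ne j$, such that $p_{i,S}=\mathbb P_\theta\big(i=\arg\max_{j\in S}\{\nu_j+\tilde\epsilon_j\}\big)$ for all $S\in\mathcal S$, $i\in S$. - $\mathcal P_{\rm MDM}(\mathcal S)$ is the set of $p$ for which there are $\nu\in\mathbb R^n$ and marginal laws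 $F_1,\dots,F_n$ on $\mathbb R$, each absolutely continuous, with finite mean and with a distribution function that is strictly increasing on its support, such that for every $S\in\mathcal S$ there is a joint law $\theta^*_S$ of $\tilde\epsilon$ that attains $\sup_{\theta}\mathbb E_\theta\big[\max_{i\in S}\{\nu_i+\tilde\epsilon_i\}\big]$ over all joint laws $\theta$ with marginals $F_1,\dots,F_n$, and $p_{i,S}=\mathbb P_{\theta^*_S}\big(i=\arg\max_{j\in S}\{\nu_j+\tilde\epsilon_j\}\big)$ for all $i\in S$. - $\mathcal P_{\rm REG}(\mathcal S)$ is the set of choice probability collections over $\mathcal S$ with $p_{i,S}\ge p_{i,T}$ whenever $S,T\in\mathcal S$, $S\subseteq T$ and $i\in S$. The collection $\mathcal S$ is nested if it is totally ordered by inclusion, and laminar if any two of its members are disjoint or related by inclusion. **Theorem.** (a) If $n=2$, then $\mathcal P_{\rm RUM}(\mathcal S)=\mathcal P_{\rm MDM}(\mathcal S)$ for every $\mathcal S$. If $n=3$, then $\mathcal P_{\rm MDM}(\mathcal S)\subseteq\mathcal P_{\rm RUM}(\mathcal S)$ for every $\mathcal S$, and the inclusion is strict for some $\mathcal S$. For every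 $n\ge 4$, $\mathcal P_{\rm MDM}(\mathcal S)\cap\mathcal P_{\rm RUM}(\mathcal S)\ne\emptyset$ for every $\mathcal S$, and there is a collection $\mathcal S$ such that $\mathcal P_{\rm MDM}(\mathcal S)\not\subseteq\mathcal P_{\rm RUM}(\mathcal S)$ and $\mathcal P_{\rm RUM}(\mathcal S)\not\subseteq\mathcal P_{\rm MDM}(\mathcal S)$. (b) For every $n$ and every $\mathcal S$ that is nested or laminar, $\mathcal P_{\rm RUM}(\mathcal S)=\overline{\mathcal P_{\rm MDM}(\mathcal S)}=\mathcal P_{\rm REG}(\mathcal S)$. -/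

import Mathlib

open MeasureTheory

namespace ChoiceModels

/-- An assortment over the products `1, …, n` is a nonempty set of products. -/
abbrev Assortment (n : ℕ) : Type := {S : Finset (Fin n) // S.Nonempty}

/-- Real vectors `(p_{i,S} : S ∈ 𝒮, i ∈ S)`, indexed by the product-assortment pairs of the
collection `𝒮`; the topology is the usual one of a finite-dimensional real space. -/
abbrev ChoiceData {n : ℕ} (𝒮 : Set (Assortment n)) : Type :=
  (S : 𝒮) → {i : Fin n // i ∈ S.1.1} → ℝ

/-- The event, in the space of the noise vectors `ε`, that `i` is the (unique) product of `S`
with the largest utility `ν i + ε i`. -/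
def argmaxEvent {n : ℕ} (ν : Fin n → ℝ) (S : Assortment n) (i : Fin n) : Set (Fin n → ℝ) :=
  {ε | i ∈ S.1 ∧ ∀ j ∈ S.1, j ≠ i → ν j + ε j < ν i + ε i}

/-- The choice probabilities over `𝒮` that are representable by the random utility model: some
deterministic utilities `ν` and some joint law `θ` of the noise, with ties of probability zero. -/
def rumSet {n : ℕ} (𝒮 : Set (Assortment n)) : Set (ChoiceData 𝒮) :=
  {p | ∃ (ν : Fin n → ℝ) (θ : Measure (Fin n → ℝ)), IsProbabilityMeasure θ ∧
    (∀ i j : Fin n, i ≠ j → θ {ε | ν i + ε i = ν j + ε j} = 0) ∧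
    ∀ (S : 𝒮) (i : {i : Fin n // i ∈ S.1.1}), p S i = θ.real (argmaxEvent ν S.1 i.1)}

/-- The admissible marginal laws of the marginal distribution model: absolutely continuous
probability laws on `ℝ` with finite mean whose distribution function is strictly increasing on
the support. -/
structure IsAdmissibleMarginal (μ : Measure ℝ) : Prop where
  isProbabilityMeasure : IsProbabilityMeasure μ
  absolutelyContinuous : μ ≪ volume
  strictMonoOn_cdf : StrictMonoOn (ProbabilityTheory.cdf μ) μ.support
  integrable_id : Integrable (fun x : ℝ => x) μ

/-- The joint laws of the noise vector with the given marginal laws. -/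
def jointLaws {n : ℕ} (F : Fin n → Measure ℝ) : Set (Measure (Fin n → ℝ)) :=
  {θ | IsProbabilityMeasure θ ∧ ∀ i, θ.map (fun ε => ε i) = F i}

/-- The expected maximal utility over the assortment `S` under the joint law `θ`. -/
noncomputable def expectedMaxUtility {n : ℕ} (ν : Fin n → ℝ) (S : Assortment n)
    (θ : Measure (Fin n → ℝ)) : ℝ :=
  ∫ ε, S.1.sup' S.2 (fun i => ν i + ε i) ∂θ

/-- The choice probabilities over `𝒮` that are representable by the marginal distribution model:
for some deterministic utilities `ν` and some admissible marginals `F`, common to all assortments,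
the choice probabilities of each `S ∈ 𝒮` are those under a joint law which maximizes the
expected maximal utility over `S` among all the joint laws with the marginals `F`. -/
def mdmSet {n : ℕ} (𝒮 : Set (Assortment n)) : Set (ChoiceData 𝒮) :=
  {p | ∃ (ν : Fin n → ℝ) (F : Fin n → Measure ℝ), (∀ i, IsAdmissibleMarginal (F i)) ∧
    ∀ S : 𝒮, ∃ θ ∈ jointLaws F, IsMaxOn (expectedMaxUtility ν S.1) (jointLaws F) θ ∧
      ∀ i : {i : Fin n // i ∈ S.1.1}, p S i = θ.real (argmaxEvent ν S.1 i.1)}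

/-- The regular choice probabilities over `𝒮`: probability vectors on the assortments of `𝒮` for
which the probability of choosing a product does not increase when the assortment is enlarged. -/
def regSet {n : ℕ} (𝒮 : Set (Assortment n)) : Set (ChoiceData 𝒮) :=
  {p | (∀ S i, 0 ≤ p S i) ∧ (∀ S, ∑ i, p S i = 1) ∧
    ∀ (S T : 𝒮) (h : S.1.1 ⊆ T.1.1) (i : {i : Fin n // i ∈ S.1.1}), p T ⟨i.1, h i.2⟩ ≤ p S i}

/-- A nested collection: its assortments form a chain under inclusion. -/
def IsNested {n : ℕ} (𝒮 : Set (Assortment n)) : Prop :=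
  ∀ S ∈ 𝒮, ∀ T ∈ 𝒮, S.1 ⊆ T.1 ∨ T.1 ⊆ S.1

/-- A laminar collection: any two of its assortments are disjoint or related by inclusion. -/
def IsLaminar {n : ℕ} (𝒮 : Set (Assortment n)) : Prop :=
  ∀ S ∈ 𝒮, ∀ T ∈ 𝒮, S.1 ⊆ T.1 ∨ T.1 ⊆ S.1 ∨ Disjoint S.1 T.1

end ChoiceModels

/-!
In the marginal distribution model, `t + ∑ i ∈ S, E (u i - t)⁺` bounds the expected maximal utility
over `S` from above for every `t`, and at the threshold `t` where the tails `P (u i > t)`, `i ∈ S`,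
add up to `1` a coupling in which exactly one utility exceeds `t` attains the bound. So the choice
probabilities from `S` are the tails at a threshold depending on `S` alone. Hence `p` is
representable exactly when the assortments can be ranked so that, for each product, a larger
probability means a lower rank, and equal probabilities strictly between `0` and `1` mean equal
ranks; conversely, marginal laws with prescribed tails at the ranks interpolate the data.

In a random utility model the choice probabilities are those of a random ranking. They are monotone
under inclusion and satisfy a supermodularity inequality over four assortments, which data
satisfying the rank condition may violate, while a mixture of a ranking and its reverse may violate
the rank condition. For three products, the Block–Marschak weights of the six rankings are
differences of two choice probabilities, so monotonicity makes them nonnegative.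

If `𝒮` is laminar and `p` is monotone, choose from the largest assortments first and pass to each
smaller one by keeping the choice of its parent whenever it is still available: this yields a
random ranking with choice probabilities `p`. Mixing `p` with a little of the uniform choice makes
the monotonicity strict, so that the cardinality is an admissible rank and `p` is a limit of points
of the marginal distribution model.
-/

namespace ChoiceModels

open Set Filter ProbabilityTheory Topology

section Marginals

variable {α : Type*} [ConditionallyCompleteLinearOrder α] [TopologicalSpace α] [OrderTopology α]
  [SecondCountableTopology α] [MeasurableSpace α] {μ : Measure α}

theorem exists_mem_support_le_measure_Ioc_eq_zero {t : α} (ht : μ (Iic t) ≠ 0) :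
    ∃ x ∈ μ.support, x ≤ t ∧ μ (Ioc x t) = 0 := by
  have hne : (μ.support ∩ Iic t).Nonempty :=
    (Measure.nonempty_inter_support_of_pos (pos_iff_ne_zero.2 ht)).mono fun _ h => ⟨h.2, h.1⟩
  obtain ⟨⟨hxs, hxt⟩, hx⟩ := (Measure.isClosed_support.inter isClosed_Iic).isGreatest_csSup hne
    (bddAbove_Iic.mono inter_subset_right)
  refine ⟨_, hxs, hxt, measure_mono_null ?_ Measure.measure_compl_support⟩
  exact fun z hz hzs => (hx ⟨hzs, hz.2⟩).not_gt hz.1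

theorem exists_mem_support_ge_measure_Ico_eq_zero {t : α} (ht : μ (Ici t) ≠ 0) :
    ∃ y ∈ μ.support, t ≤ y ∧ μ (Ico t y) = 0 := by
  have hne : (μ.support ∩ Ici t).Nonempty :=
    (Measure.nonempty_inter_support_of_pos (pos_iff_ne_zero.2 ht)).mono fun _ h => ⟨h.2, h.1⟩
  obtain ⟨⟨hys, hty⟩, hy⟩ := (Measure.isClosed_support.inter isClosed_Ici).isLeast_csInf hne
    (bddBelow_Ici.mono inter_subset_right)
  refine ⟨_, hys, hty, measure_mono_null ?_ Measure.measure_compl_support⟩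
  exact fun z hz hzs => (hy ⟨hzs, hz.1⟩).not_gt hz.2

variable {μ : Measure ℝ}

theorem real_Ioi_eq_one_sub_cdf [IsProbabilityMeasure μ] (t : ℝ) :
    μ.real (Ioi t) = 1 - cdf μ t := by
  rw [cdf_eq_real, ← compl_Iic, probReal_compl_eq_one_sub measurableSet_Iic]

theorem support_subset_Iic_of_real_Ioi_eq_zero [IsFiniteMeasure μ] {t : ℝ}
    (h : μ.real (Ioi t) = 0) : μ.support ⊆ Iic t :=
  Measure.support_subset_of_isClosed isClosed_Iic <| by
    rwa [mem_ae_iff, compl_Iic, ← measureReal_eq_zero_iff]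

theorem support_subset_Ici_of_real_Ioi_eq_one [IsProbabilityMeasure μ] {t : ℝ}
    (h : μ.real (Ioi t) = 1) : μ.support ⊆ Ici t :=
  Measure.support_subset_of_isClosed isClosed_Ici <| by
    refine mem_of_superset ?_ Ioi_subset_Ici_self
    rw [mem_ae_iff, ← measureReal_eq_zero_iff, probReal_compl_eq_one_sub measurableSet_Ioi, h,
      sub_self]

theorem cdf_eq_cdf_iff_measure_Ioc_eq_zero [IsProbabilityMeasure μ] {x y : ℝ} (hxy : x ≤ y) :
    cdf μ x = cdf μ y ↔ μ (Ioc x y) = 0 := by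
  conv_rhs => rw [← measure_cdf μ]
  rw [StieltjesFunction.measure_Ioc, ENNReal.ofReal_eq_zero, sub_nonpos]
  exact ⟨ge_of_eq, (monotone_cdf μ hxy).antisymm⟩

theorem continuous_cdf [IsProbabilityMeasure μ] [NullSingletonClass μ] : Continuous (cdf μ) := by
  refine continuous_iff_continuousAt.2 fun a => ?_
  rw [(monotone_cdf μ).continuousAt_iff_leftLim_eq_rightLim, StieltjesFunction.rightLim_eq]
  refine ((monotone_cdf μ).leftLim_le le_rfl).antisymm ?_
  have h : μ {a} = ENNReal.ofReal (cdf μ a - Function.leftLim (cdf μ) a) := by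
    rw [← StieltjesFunction.measure_singleton, measure_cdf]
  simpa [eq_comm (a := (0 : ENNReal))] using h

theorem IsAdmissibleMarginal.nullSingletonClass (hμ : IsAdmissibleMarginal μ) :
    NullSingletonClass μ :=
  ⟨fun x => hμ.absolutelyContinuous (measure_singleton x)⟩

theorem IsAdmissibleMarginal.injOn_cdf (hμ : IsAdmissibleMarginal μ) :
    InjOn (cdf μ) (cdf μ ⁻¹' Ioo 0 1) := by
  have := hμ.isProbabilityMeasure
  have := hμ.nullSingletonClass
  intro s hs t ht hst
  wlog hle : s ≤ t generalizing s t
  · exact (this ht hs hst.symm (le_of_not_ge hle)).symm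
  have hIic : μ (Iic s) ≠ 0 := by
    rw [← ofReal_cdf, Ne, ENNReal.ofReal_eq_zero, not_le]
    exact hs.1
  have hIci : μ (Ici t) ≠ 0 := by
    rw [← measure_congr Ioi_ae_eq_Ici, ← measureReal_ne_zero_iff, real_Ioi_eq_one_sub_cdf]
    exact (sub_pos.2 ht.2).ne'
  obtain ⟨x, hx, hxs, hxs0⟩ := exists_mem_support_le_measure_Ioc_eq_zero hIic
  obtain ⟨y, hy, hty, hty0⟩ := exists_mem_support_ge_measure_Ico_eq_zero hIci
  rw [measure_congr Ico_ae_eq_Ioc] at hty0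
  rw [← cdf_eq_cdf_iff_measure_Ioc_eq_zero hxs] at hxs0
  rw [← cdf_eq_cdf_iff_measure_Ioc_eq_zero hty] at hty0
  have hxy : x = y := hμ.strictMonoOn_cdf.injOn hx hy (hxs0.trans (hst.trans hty0))
  exact hle.antisymm (hty.trans (hxy ▸ hxs))

end Marginals

section DualBound

variable {ι : Type*} {S : Finset ι} {u : ι → ℝ} {t : ℝ} {i j : ι}

theorem sup'_le_add_sum_max (hS : S.Nonempty) (u : ι → ℝ) (t : ℝ) :
    S.sup' hS u ≤ t + ∑ i ∈ S, max (u i - t) 0 := by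
  refine Finset.sup'_le _ _ fun i hi => ?_
  have h := Finset.single_le_sum (f := fun i => max (u i - t) 0) (fun j _ => le_max_right _ _) hi
  linarith [le_max_left (u i - t) 0]

theorem sup'_eq_add_sum_max (hS : S.Nonempty) (hi : i ∈ S) (hit : t < u i)
    (h : ∀ j ∈ S, j ≠ i → u j ≤ t) : S.sup' hS u = t + ∑ i ∈ S, max (u i - t) 0 := by
  refine (sup'_le_add_sum_max hS u t).antisymm ?_
  rw [Finset.sum_eq_single_of_mem i hi fun j hj hji => max_eq_right (sub_nonpos.2 (h j hj hji)),
    max_eq_left (sub_nonneg.2 hit.le), add_sub_cancel]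
  exact Finset.le_sup' u hi

theorem le_of_sup'_eq_add_sum_max (hS : S.Nonempty)
    (h : S.sup' hS u = t + ∑ i ∈ S, max (u i - t) 0) (hi : i ∈ S) (hj : j ∈ S) (hji : j ≠ i)
    (hit : t < u i) : u j ≤ t := by
  classical
  obtain ⟨k, hk, hmax⟩ := S.exists_mem_eq_sup' hS u
  have hrest : ∑ l ∈ S.erase k, max (u l - t) 0 = 0 := by
    have htk : t < u k := hit.trans_le (hmax ▸ Finset.le_sup' u hi)
    rw [hmax, ← Finset.add_sum_erase _ _ hk, max_eq_left (sub_nonneg.2 htk.le)] at h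
    linarith
  have hle : ∀ l ∈ S, l ≠ k → u l ≤ t := fun l hl hlk =>
    sub_nonpos.1 (max_eq_right_iff.1 ((Finset.sum_eq_zero_iff_of_nonneg fun _ _ =>
      le_max_right _ _).1 hrest l (Finset.mem_erase.2 ⟨hlk, hl⟩)))
  have hik : i = k := by_contra fun hik => (hle i hi hik).not_gt hit
  exact hle j hj (hik ▸ hji)

end DualBound

section ExclusiveCoupling

theorem smul_cond_add_smul_cond_compl {X : Type*} [MeasurableSpace X] {A : Set X}
    (hA : MeasurableSet A) (μ : Measure X) [IsFiniteMeasure μ] :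
    μ A • μ[|A] + μ Aᶜ • μ[|Aᶜ] = μ := by
  ext B
  simpa [mul_comm] using cond_add_cond_compl_eq hA μ (t := B)

variable {ι : Type*} [Fintype ι] [DecidableEq ι] {X : ι → Type*} [∀ i, MeasurableSpace (X i)]
  {F : ∀ i, Measure (X i)} {A : ∀ i, Set (X i)}

/-- The coupling of the laws `F i` in which exactly one coordinate `i`, drawn with probability
`F i (A i)`, falls in its set `A i`. It serves when these probabilities add up to `1`. -/
noncomputable def exclusiveCoupling (F : ∀ i, Measure (X i)) (A : ∀ i, Set (X i)) :
    Measure (∀ i, X i) :=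
  ∑ i, F i (A i) • Measure.pi fun j => (F j)[|if j = i then A j else (A j)ᶜ]

theorem isProbabilityMeasure_cond_ite [∀ i, IsProbabilityMeasure (F i)]
    (hA : ∀ i, MeasurableSet (A i)) (hsum : ∑ i, F i (A i) = 1) {i : ι} (hi : F i (A i) ≠ 0)
    (j : ι) : IsProbabilityMeasure (F j)[|if j = i then A j else (A j)ᶜ] := by
  refine cond_isProbabilityMeasure ?_
  split_ifs with hji
  · rwa [hji]
  · rw [Ne, prob_compl_eq_zero_iff (hA j)]
    intro hj
    have hle : F j (A j) + F i (A i) ≤ 1 := by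
      rw [← hsum, ← Finset.sum_pair (f := fun k => F k (A k)) hji]
      exact Finset.sum_le_sum_of_subset (Finset.subset_univ _)
    exact (ENNReal.lt_add_right ENNReal.one_ne_top hi).not_ge (hj ▸ hle)

variable [∀ i, IsProbabilityMeasure (F i)]

theorem isProbabilityMeasure_exclusiveCoupling (hA : ∀ i, MeasurableSet (A i))
    (hsum : ∑ i, F i (A i) = 1) : IsProbabilityMeasure (exclusiveCoupling F A) := by
  refine ⟨?_⟩
  rw [exclusiveCoupling, Measure.finsetSum_apply, ← hsum]
  refine Finset.sum_congr rfl fun i _ => ?_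
  by_cases hi : F i (A i) = 0
  · simp [hi]
  · have := isProbabilityMeasure_cond_ite hA hsum hi
    simp

theorem map_eval_exclusiveCoupling (hA : ∀ i, MeasurableSet (A i)) (hsum : ∑ i, F i (A i) = 1)
    (j : ι) : (exclusiveCoupling F A).map (fun x => x j) = F j := by
  have hterm (i : ι) : (F i (A i) • Measure.pi fun j => (F j)[|if j = i then A j else (A j)ᶜ]).map
      (fun x => x j) = F i (A i) • (F j)[|if j = i then A j else (A j)ᶜ] := by
    by_cases hi : F i (A i) = 0
    · simp [hi]
    · have := isProbabilityMeasure_cond_ite hA hsum hi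
      rw [Measure.map_smul]
      exact congrArg _ (measurePreserving_eval _ j).map_eq
  have hcompl : ∑ i ∈ {j}ᶜ, F i (A i) = F j (A j)ᶜ := by
    rw [prob_compl_eq_one_sub (hA j), ← hsum, Fintype.sum_eq_add_sum_compl j,
      ENNReal.add_sub_cancel_left (measure_ne_top _ _)]
  rw [exclusiveCoupling, Measure.map_finset_sum (measurable_pi_apply j).aemeasurable,
    Finset.sum_congr rfl fun i _ => hterm i, Fintype.sum_eq_add_sum_compl j, if_pos rfl]
  rw [Finset.sum_congr rfl fun i hi => by
    rw [if_neg (Ne.symm (Finset.notMem_singleton.1 (Finset.mem_compl.1 hi)))], ← Finset.sum_smul,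
    hcompl, smul_cond_add_smul_cond_compl (hA j)]

theorem ae_exclusiveCoupling (hA : ∀ i, MeasurableSet (A i)) (hsum : ∑ i, F i (A i) = 1) :
    ∀ᵐ x ∂exclusiveCoupling F A, ∃ i, ∀ j, x j ∈ A j ↔ j = i := by
  rw [exclusiveCoupling, ae_finsetSum_measure_iff]
  intro i _
  by_cases hi : F i (A i) = 0
  · simp [hi]
  have := isProbabilityMeasure_cond_ite hA hsum hi
  have hcoord (j : ι) : ∀ᵐ x ∂(F j)[|if j = i then A j else (A j)ᶜ], x ∈ A j ↔ j = i := by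
    split_ifs with hji
    · simpa [hji] using ae_cond_mem (hA j)
    · simpa [hji] using ae_cond_mem (hA j).compl
  refine Measure.ae_smul_measure ?_ _
  filter_upwards [ae_all_iff.2 fun j => (measurePreserving_eval (fun j =>
    (F j)[|if j = i then A j else (A j)ᶜ]) j).quasiMeasurePreserving.ae (hcoord j)] with x hx
  exact ⟨i, hx⟩

end ExclusiveCoupling

section OptimalCoupling

variable {n : ℕ} {ν : Fin n → ℝ} {F : Fin n → Measure ℝ} {S : Assortment n} {t : ℝ}
  {θ : Measure (Fin n → ℝ)} {i : Fin n}

theorem measurableSet_argmaxEvent (ν : Fin n → ℝ) (S : Assortment n) (i : Fin n) :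
    MeasurableSet (argmaxEvent ν S i) := by
  have h : argmaxEvent ν S i =
      {_ε | i ∈ S.1} ∩ ⋂ j ∈ S.1.erase i, {ε | ν j + ε j < ν i + ε i} := by
    ext ε
    simp only [argmaxEvent, mem_ofPred_eq, mem_inter_iff, mem_iInter, Finset.mem_erase]
    grind
  rw [h]
  exact (MeasurableSet.const _).inter
    (Finset.measurableSet_biInter _ fun j _ => measurableSet_lt (by fun_prop) (by fun_prop))

theorem pairwiseDisjoint_argmaxEvent (ν : Fin n → ℝ) (S : Assortment n) (s : Set (Fin n)) :
    s.PairwiseDisjoint (argmaxEvent ν S) := fun i _ j _ hij =>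
  Set.disjoint_left.2 fun _ hi hj => lt_asymm (hi.2 j hj.1 hij.symm) (hj.2 i hi.1 hij)

theorem sum_real_argmaxEvent_le_one (ν : Fin n → ℝ) (S : Assortment n)
    (θ : Measure (Fin n → ℝ)) [IsProbabilityMeasure θ] :
    ∑ i ∈ S.1, θ.real (argmaxEvent ν S i) ≤ 1 := by
  rw [← measureReal_biUnion_finset (pairwiseDisjoint_argmaxEvent ν S _)
    fun i _ => measurableSet_argmaxEvent ν S i]
  exact measureReal_le_one

/-- The probability that the utility of the product `i` exceeds the threshold `t`. These are the
choice probabilities of the marginal distribution model, once `t` is chosen such that they add up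
to `1` over the assortment. -/
noncomputable def exceedanceProb (ν : Fin n → ℝ) (F : Fin n → Measure ℝ) (t : ℝ) (i : Fin n) : ℝ :=
  (F i).real (Ioi (t - ν i))

theorem exceedanceProb_nonneg (t : ℝ) (i : Fin n) : 0 ≤ exceedanceProb ν F t i :=
  measureReal_nonneg

theorem exceedanceProb_antitone [∀ i, IsProbabilityMeasure (F i)] (i : Fin n) :
    Antitone fun t => exceedanceProb ν F t i :=
  fun _ _ h => measureReal_mono (Ioi_subset_Ioi (sub_le_sub_right h _))

theorem exceedanceProb_injOn (hF : ∀ i, IsAdmissibleMarginal (F i)) (i : Fin n) :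
    InjOn (fun t => exceedanceProb ν F t i) ((fun t => exceedanceProb ν F t i) ⁻¹' Ioo 0 1) := by
  have := (hF i).isProbabilityMeasure
  have hmem {t : ℝ} (ht : 1 - cdf (F i) (t - ν i) ∈ Ioo (0 : ℝ) 1) :
      cdf (F i) (t - ν i) ∈ Ioo (0 : ℝ) 1 := ⟨by linarith [ht.2], by linarith [ht.1]⟩
  intro s hs t ht hst
  simp only [mem_preimage, exceedanceProb, real_Ioi_eq_one_sub_cdf, sub_right_inj] at hs ht hst
  exact sub_left_injective ((hF i).injOn_cdf (hmem hs) (hmem ht) hst)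

theorem exceedanceProb_eq_real (hθ : θ ∈ jointLaws F) (t : ℝ) (i : Fin n) :
    exceedanceProb ν F t i = θ.real {ε | t < ν i + ε i} := by
  rw [exceedanceProb, ← hθ.2 i, map_measureReal_apply (measurable_pi_apply i) measurableSet_Ioi]
  simp only [preimage, mem_Ioi, sub_lt_iff_lt_add']

/-- The upper bound on the expected maximal utility that the threshold `t` provides, the dual
objective of the optimization over the joint laws. -/
noncomputable def dualBound (ν : Fin n → ℝ) (F : Fin n → Measure ℝ) (S : Assortment n)
    (t : ℝ) : ℝ :=
  t + ∑ i ∈ S.1, ∫ x, max (ν i + x - t) 0 ∂(F i)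

section Integrable

variable (hF : ∀ i, Integrable (fun x : ℝ => x) (F i)) (hθ : θ ∈ jointLaws F)
include hF hθ

theorem integrable_utility (i : Fin n) : Integrable (fun ε : Fin n → ℝ => ν i + ε i) θ := by
  have := hθ.1
  have h := hF i
  rw [← hθ.2 i] at h
  exact (integrable_const _).add <| (integrable_map_measure aestronglyMeasurable_id
    (measurable_pi_apply i).aemeasurable).1 h

theorem integrable_max_utility (S : Assortment n) :
    Integrable (fun ε : Fin n → ℝ => S.1.sup' S.2 (fun i => ν i + ε i)) θ := by
  have h : Integrable (S.1.sup' S.2 (fun i (ε : Fin n → ℝ) => ν i + ε i)) θ :=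
    Finset.sup'_induction (p := fun f => Integrable f θ) S.2 _
      (fun f hf g hg => Integrable.sup hf hg) fun i _ => integrable_utility hF hθ i
  exact h.congr (Eventually.of_forall fun ε => Finset.sup'_apply _ _ _)

theorem integrable_pos_part_utility (t : ℝ) (i : Fin n) :
    Integrable (fun ε : Fin n → ℝ => max (ν i + ε i - t) 0) θ :=
  have := hθ.1
  ((integrable_utility hF hθ i).sub (integrable_const _)).pos_part

theorem integrable_add_sum_max_utility (S : Assortment n) (t : ℝ) :
    Integrable (fun ε : Fin n → ℝ => t + ∑ i ∈ S.1, max (ν i + ε i - t) 0) θ :=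
  have := hθ.1
  (integrable_const _).add (integrable_finsetSum _ fun i _ => integrable_pos_part_utility hF hθ t i)

theorem integral_add_sum_max_utility (S : Assortment n) (t : ℝ) :
    ∫ ε, (t + ∑ i ∈ S.1, max (ν i + ε i - t) 0) ∂θ = dualBound ν F S t := by
  have := hθ.1
  have hint (i : Fin n) := integrable_pos_part_utility (ν := ν) hF hθ t i
  have hmap (i : Fin n) : ∫ ε : Fin n → ℝ, max (ν i + ε i - t) 0 ∂θ =
      ∫ x, max (ν i + x - t) 0 ∂(F i) := by
    rw [← hθ.2 i, integral_map (measurable_pi_apply i).aemeasurable (by fun_prop)]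
  rw [integral_add (integrable_const _) (integrable_finsetSum _ fun i _ => hint i),
    integral_finsetSum _ fun i _ => hint i, dualBound]
  simp [hmap]

theorem expectedMaxUtility_le_dualBound (S : Assortment n) (t : ℝ) :
    expectedMaxUtility ν S θ ≤ dualBound ν F S t := by
  rw [← integral_add_sum_max_utility hF hθ S t]
  exact integral_mono (integrable_max_utility hF hθ S) (integrable_add_sum_max_utility hF hθ S t)
    fun ε => sup'_le_add_sum_max S.2 _ t

theorem expectedMaxUtility_eq_dualBound_iff (S : Assortment n) (t : ℝ) :
    expectedMaxUtility ν S θ = dualBound ν F S t ↔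
      ∀ᵐ ε ∂θ, S.1.sup' S.2 (fun i => ν i + ε i) = t + ∑ i ∈ S.1, max (ν i + ε i - t) 0 := by
  rw [← integral_add_sum_max_utility hF hθ S t]
  exact integral_eq_iff_of_ae_le (integrable_max_utility hF hθ S)
    (integrable_add_sum_max_utility hF hθ S t)
    (Eventually.of_forall fun ε => sup'_le_add_sum_max S.2 _ t)

end Integrable

theorem exists_mem_jointLaws_ae_unique_exceedance [∀ i, IsProbabilityMeasure (F i)]
    (ht : ∑ i ∈ S.1, exceedanceProb ν F t i = 1) :
    ∃ θ ∈ jointLaws F, ∀ᵐ ε ∂θ, ∃ i ∈ S.1, t < ν i + ε i ∧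
      ∀ j ∈ S.1, j ≠ i → ν j + ε j ≤ t := by
  let A (i : Fin n) : Set ℝ := if i ∈ S.1 then Ioi (t - ν i) else ∅
  have hmem (i : Fin n) (x : ℝ) : x ∈ A i ↔ i ∈ S.1 ∧ t < ν i + x := by
    by_cases hi : i ∈ S.1 <;> simp [A, hi, sub_lt_iff_lt_add']
  have hA (i : Fin n) : MeasurableSet (A i) := by
    by_cases hi : i ∈ S.1 <;> simp [A, hi, measurableSet_Ioi]
  have hsum : ∑ i, F i (A i) = 1 := by
    rw [← Finset.sum_subset (Finset.subset_univ S.1) fun i _ hi => by simp [A, hi],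
      ← ENNReal.toReal_eq_one_iff, ENNReal.toReal_sum fun i _ => measure_ne_top _ _, ← ht]
    exact Finset.sum_congr rfl fun i hi => by simp only [A, if_pos hi]; rfl
  refine ⟨exclusiveCoupling F A, ⟨isProbabilityMeasure_exclusiveCoupling hA hsum,
    map_eval_exclusiveCoupling hA hsum⟩, ?_⟩
  filter_upwards [ae_exclusiveCoupling hA hsum] with ε ⟨i, hi⟩
  simp only [hmem] at hi
  obtain ⟨hiS, hit⟩ := (hi i).2 rfl
  exact ⟨i, hiS, hit, fun j hj hji => not_lt.1 fun hjt => hji ((hi j).1 ⟨hj, hjt⟩)⟩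

variable (hF : ∀ i, IsAdmissibleMarginal (F i))
include hF

theorem exists_expectedMaxUtility_eq_dualBound (ht : ∑ i ∈ S.1, exceedanceProb ν F t i = 1) :
    ∃ θ ∈ jointLaws F, expectedMaxUtility ν S θ = dualBound ν F S t := by
  have (i : Fin n) := (hF i).isProbabilityMeasure
  obtain ⟨θ, hθ, h⟩ := exists_mem_jointLaws_ae_unique_exceedance ht
  refine ⟨θ, hθ, (expectedMaxUtility_eq_dualBound_iff (fun i => (hF i).integrable_id) hθ S t).2 ?_⟩
  filter_upwards [h] with ε ⟨i, hi, hit, hj⟩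
  exact sup'_eq_add_sum_max S.2 hi hit hj

theorem isMaxOn_iff_eq_dualBound (ht : ∑ i ∈ S.1, exceedanceProb ν F t i = 1)
    (hθ : θ ∈ jointLaws F) :
    IsMaxOn (expectedMaxUtility ν S) (jointLaws F) θ ↔
      expectedMaxUtility ν S θ = dualBound ν F S t := by
  have hle {η : Measure (Fin n → ℝ)} (hη : η ∈ jointLaws F) :=
    expectedMaxUtility_le_dualBound (ν := ν) (fun i => (hF i).integrable_id) hη S t
  obtain ⟨θ₀, hθ₀, h₀⟩ := exists_expectedMaxUtility_eq_dualBound hF ht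
  exact ⟨fun hmax => (hle hθ).antisymm (h₀ ▸ hmax hθ₀), fun h η hη => h ▸ hle hη⟩

theorem real_argmaxEvent_of_isMaxOn (ht : ∑ i ∈ S.1, exceedanceProb ν F t i = 1)
    (hθ : θ ∈ jointLaws F) (hmax : IsMaxOn (expectedMaxUtility ν S) (jointLaws F) θ)
    (hi : i ∈ S.1) : θ.real (argmaxEvent ν S i) = exceedanceProb ν F t i := by
  have := hθ.1
  have htight := (expectedMaxUtility_eq_dualBound_iff (fun i => (hF i).integrable_id) hθ S t).1
    ((isMaxOn_iff_eq_dualBound hF ht hθ).1 hmax)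
  -- Almost surely a product above the threshold is chosen; both sides add up to at most `1`.
  have hle : ∀ j ∈ S.1, exceedanceProb ν F t j ≤ θ.real (argmaxEvent ν S j) := by
    intro j hj
    rw [exceedanceProb_eq_real hθ]
    refine ENNReal.toReal_mono (measure_ne_top _ _) (measure_mono_ae ?_)
    filter_upwards [htight] with ε hε hjt
    exact ⟨hj, fun k hk hkj => (le_of_sup'_eq_add_sum_max S.2 hε hj hk hkj hjt).trans_lt hjt⟩
  refine ((Finset.sum_eq_sum_iff_of_le hle).1 ((Finset.sum_le_sum hle).antisymm ?_) i hi).symm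
  exact ht ▸ sum_real_argmaxEvent_le_one ν S θ

theorem exists_sum_exceedanceProb_eq_one (ν : Fin n → ℝ) (hS : 1 < S.1.card) :
    ∃ t, ∑ i ∈ S.1, exceedanceProb ν F t i = 1 := by
  have (i : Fin n) := (hF i).isProbabilityMeasure
  have (i : Fin n) := (hF i).nullSingletonClass
  have hcdf (i : Fin n) : Continuous (cdf (F i)) := continuous_cdf
  simp only [exceedanceProb, real_Ioi_eq_one_sub_cdf]
  have hbot : Tendsto (fun t => ∑ i ∈ S.1, (1 - cdf (F i) (t - ν i))) atBot
      (𝓝 (∑ i ∈ S.1, (1 - 0))) :=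
    tendsto_finsetSum _ fun i _ => tendsto_const_nhds.sub <|
      (tendsto_cdf_atBot _).comp (tendsto_atBot_add_const_right _ _ tendsto_id)
  have htop : Tendsto (fun t => ∑ i ∈ S.1, (1 - cdf (F i) (t - ν i))) atTop
      (𝓝 (∑ i ∈ S.1, (1 - 1))) :=
    tendsto_finsetSum _ fun i _ => tendsto_const_nhds.sub <|
      (tendsto_cdf_atTop _).comp (tendsto_atTop_add_const_right _ _ tendsto_id)
  refine mem_range_of_exists_le_of_exists_ge (by fun_prop) ?_ ?_
  · exact ((htop.eventually_lt_const (u := 1) (by simp)).exists).imp fun _ h => h.le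
  · exact ((hbot.eventually_const_lt (u := 1) (by simpa using hS)).exists).imp fun _ h => h.le

end OptimalCoupling

section Threshold

variable {n : ℕ} {𝒮 : Set (Assortment n)} {ν : Fin n → ℝ} {F : Fin n → Measure ℝ}

theorem real_argmaxEvent_of_card_eq_one {S : Assortment n} (hS : S.1.card = 1) {i : Fin n}
    (hi : i ∈ S.1) (θ : Measure (Fin n → ℝ)) [IsProbabilityMeasure θ] :
    θ.real (argmaxEvent ν S i) = 1 := by
  have h : argmaxEvent ν S i = univ := eq_univ_of_forall fun ε =>
    ⟨hi, fun j hj hji => absurd (Finset.card_le_one.1 hS.le j hj i hi) hji⟩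
  rw [h, probReal_univ]

theorem expectedMaxUtility_of_card_eq_one {S : Assortment n} (hS : S.1.card = 1) {i : Fin n}
    (hi : i ∈ S.1) {θ : Measure (Fin n → ℝ)} (hθ : θ ∈ jointLaws F) :
    expectedMaxUtility ν S θ = ∫ x, (ν i + x) ∂(F i) := by
  have h (ε : Fin n → ℝ) : S.1.sup' S.2 (fun j => ν j + ε j) = ν i + ε i :=
    (Finset.sup'_congr S.2 rfl fun j hj => by
      rw [Finset.card_le_one.1 hS.le j hj i hi]).trans (Finset.sup'_const S.2 _)
  rw [← hθ.2 i, integral_map (measurable_pi_apply i).aemeasurable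
    (by fun_prop : Continuous fun x : ℝ => ν i + x).aestronglyMeasurable]
  exact integral_congr_ae (Eventually.of_forall h)

theorem exists_isMaxOn_expectedMaxUtility (hF : ∀ i, IsAdmissibleMarginal (F i)) (ν : Fin n → ℝ)
    (S : Assortment n) : ∃ θ ∈ jointLaws F, IsMaxOn (expectedMaxUtility ν S) (jointLaws F) θ := by
  rcases (Nat.succ_le_of_lt S.2.card_pos).eq_or_lt' with hS | hS
  · have (i : Fin n) := (hF i).isProbabilityMeasure
    have hpi : Measure.pi F ∈ jointLaws F :=
      ⟨inferInstance, fun i => (measurePreserving_eval F i).map_eq⟩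
    obtain ⟨i, hi⟩ := S.2
    refine ⟨_, hpi, fun θ hθ => ?_⟩
    exact (expectedMaxUtility_of_card_eq_one hS hi hθ).trans_le
      (expectedMaxUtility_of_card_eq_one hS hi hpi).ge
  · obtain ⟨t, ht⟩ := exists_sum_exceedanceProb_eq_one hF ν hS
    obtain ⟨θ, hθ, h⟩ := exists_expectedMaxUtility_eq_dualBound hF ht
    exact ⟨θ, hθ, (isMaxOn_iff_eq_dualBound hF ht hθ).2 h⟩

theorem mem_mdmSet_of_thresholds {p : ChoiceData 𝒮} (hF : ∀ i, IsAdmissibleMarginal (F i))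
    (hsum : ∀ S, ∑ i, p S i = 1) (t : 𝒮 → ℝ)
    (hp : ∀ S i, p S i = exceedanceProb ν F (t S) i.1) : p ∈ mdmSet 𝒮 := by
  refine ⟨ν, F, hF, fun S => ?_⟩
  have ht : ∑ i ∈ S.1.1, exceedanceProb ν F (t S) i = 1 := by
    rw [← hsum S, ← Finset.sum_coe_sort]
    exact Finset.sum_congr rfl fun i _ => (hp S i).symm
  obtain ⟨θ, hθ, h⟩ := exists_expectedMaxUtility_eq_dualBound hF ht
  have hmax := (isMaxOn_iff_eq_dualBound hF ht hθ).2 h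
  exact ⟨θ, hθ, hmax, fun i => by rw [hp, real_argmaxEvent_of_isMaxOn hF ht hθ hmax i.2]⟩

theorem exists_thresholds_of_mem_mdmSet {p : ChoiceData 𝒮} (hp : p ∈ mdmSet 𝒮) :
    ∃ (ν : Fin n → ℝ) (F : Fin n → Measure ℝ), (∀ i, IsAdmissibleMarginal (F i)) ∧
      ∀ S : 𝒮, (S.1.1.card = 1 ∧ ∀ i, p S i = 1) ∨
        ∃ t, ∑ i ∈ S.1.1, exceedanceProb ν F t i = 1 ∧
          ∀ i, p S i = exceedanceProb ν F t i.1 := by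
  obtain ⟨ν, F, hF, h⟩ := hp
  refine ⟨ν, F, hF, fun S => ?_⟩
  obtain ⟨θ, hθ, hmax, hpS⟩ := h S
  rcases (Nat.succ_le_of_lt S.1.2.card_pos).eq_or_lt' with hS | hS
  · have := hθ.1
    exact Or.inl ⟨hS, fun i => by rw [hpS, real_argmaxEvent_of_card_eq_one hS i.2]⟩
  · obtain ⟨t, ht⟩ := exists_sum_exceedanceProb_eq_one hF ν hS
    exact Or.inr ⟨t, ht, fun i => by rw [hpS, real_argmaxEvent_of_isMaxOn hF ht hθ hmax i.2]⟩

theorem exists_extension_of_mem_mdmSet {p : ChoiceData 𝒮} (hp : p ∈ mdmSet 𝒮) :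
    ∃ q ∈ mdmSet (univ : Set (Assortment n)), ∀ S i, p S i = q ⟨S.1, mem_univ _⟩ i := by
  obtain ⟨ν, F, hF, h⟩ := hp
  have hθ (S : Assortment n) : ∃ θ ∈ jointLaws F,
      IsMaxOn (expectedMaxUtility ν S) (jointLaws F) θ ∧ ∀ (hS : S ∈ 𝒮) (i : {i // i ∈ S.1}),
        p ⟨S, hS⟩ i = θ.real (argmaxEvent ν S i.1) := by
    by_cases hS : S ∈ 𝒮
    · obtain ⟨θ, hθ, hmax, hpS⟩ := h ⟨S, hS⟩
      exact ⟨θ, hθ, hmax, fun _ => hpS⟩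
    · obtain ⟨θ, hθ, hmax⟩ := exists_isMaxOn_expectedMaxUtility hF ν S
      exact ⟨θ, hθ, hmax, fun hS' => absurd hS' hS⟩
  choose θ hθ hmax hp using hθ
  exact ⟨fun S i => (θ S.1).real (argmaxEvent ν S.1 i.1),
    ⟨ν, F, hF, fun S => ⟨θ S.1, hθ S.1, hmax S.1, fun _ => rfl⟩⟩, fun S i => hp S.1 S.2 i⟩

theorem mem_stdSimplex_of_mem_mdmSet {p : ChoiceData 𝒮} (hp : p ∈ mdmSet 𝒮) (S : 𝒮) :
    p S ∈ stdSimplex ℝ {i // i ∈ S.1.1} := by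
  obtain ⟨ν, F, -, h⟩ := exists_thresholds_of_mem_mdmSet hp
  rcases h S with ⟨hS, h⟩ | ⟨t, ht, h⟩
  · exact ⟨fun i => by simp [h], by simp [h, hS]⟩
  · refine ⟨fun i => (h i).symm ▸ exceedanceProb_nonneg _ _, ?_⟩
    rw [← ht, ← Finset.sum_coe_sort S.1.1 (exceedanceProb ν F t)]
    exact Finset.sum_congr rfl fun i _ => h i

end Threshold

section LevelFunction

variable {n : ℕ} {𝒮 : Set (Assortment n)} {α : Type*} [LinearOrder α] {p : ChoiceData 𝒮}
  {r : 𝒮 → α}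

/-- A level function of the choice probabilities `p` orders the assortments in the way in which
the thresholds of a representation by the marginal distribution model do: a higher level means
smaller choice probabilities, and a choice probability in `(0, 1)` determines the level. -/
def IsLevelFunction (p : ChoiceData 𝒮) (r : 𝒮 → α) : Prop :=
  ∀ ⦃S T : 𝒮⦄ ⦃i : Fin n⦄ (hS : i ∈ S.1.1) (hT : i ∈ T.1.1),
    (p T ⟨i, hT⟩ < p S ⟨i, hS⟩ → r S < r T) ∧
      (p S ⟨i, hS⟩ = p T ⟨i, hT⟩ → p S ⟨i, hS⟩ ∈ Ioo (0 : ℝ) 1 → r S = r T)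

theorem isLevelFunction_of_antitone {g : Fin n → α → ℝ} (hanti : ∀ i, Antitone (g i))
    (hinj : ∀ i, InjOn (g i) (g i ⁻¹' Ioo 0 1)) (hp : ∀ S i, p S i = g i.1 (r S)) :
    IsLevelFunction p r := by
  intro S T i hS hT
  simp only [hp]
  exact ⟨(hanti i).reflect_lt, fun h h01 => hinj i h01 (mem_preimage.2 (h ▸ h01)) h⟩

theorem exists_isLevelFunction_of_mem_mdmSet (hp : p ∈ mdmSet 𝒮) :
    ∃ r : 𝒮 → WithBot ℝ, IsLevelFunction p r := by
  obtain ⟨ν, F, hF, h⟩ := exists_thresholds_of_mem_mdmSet hp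
  have (i : Fin n) := (hF i).isProbabilityMeasure
  -- A singleton gets the threshold `⊥`, which every utility exceeds.
  let g (i : Fin n) : WithBot ℝ → ℝ := WithBot.recBotCoe 1 fun t => exceedanceProb ν F t i
  have hr (S : 𝒮) : ∃ r : WithBot ℝ, ∀ i, p S i = g i.1 r := by
    rcases h S with ⟨-, h⟩ | ⟨t, -, h⟩
    exacts [⟨⊥, h⟩, ⟨t, h⟩]
  choose r hr using hr
  refine ⟨r, isLevelFunction_of_antitone (fun i => ?_) (fun i => ?_) hr⟩
  · intro s t hst
    induction s with
    | bot =>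
      induction t with
      | bot => exact le_rfl
      | coe t => exact measureReal_le_one
    | coe s =>
      induction t with
      | bot => exact absurd hst (WithBot.not_coe_le_bot s)
      | coe t => exact exceedanceProb_antitone i (WithBot.coe_le_coe.1 hst)
  · intro s hs t ht hst
    induction s with
    | bot => exact absurd hs.2 (lt_irrefl 1)
    | coe s =>
      induction t with
      | bot => exact absurd ht.2 (lt_irrefl 1)
      | coe t => exact congrArg _ (exceedanceProb_injOn hF i hs ht hst)

theorem sum_comp_inclusion_le {ι : Type*} {S T : Finset ι} (h : S ⊆ T) {f : {i // i ∈ T} → ℝ}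
    (hf : ∀ i, 0 ≤ f i) : ∑ i : {i // i ∈ S}, f ⟨i.1, h i.2⟩ ≤ ∑ i, f i :=
  (Finset.sum_map Finset.univ ⟨_, inclusion_injective h⟩ f).symm.trans_le
    (Finset.sum_le_univ_sum_of_nonneg hf)

theorem IsLevelFunction.le_of_subset (hr : IsLevelFunction p r)
    (hp : ∀ S : 𝒮, p S ∈ stdSimplex ℝ {i // i ∈ S.1.1}) {S T : 𝒮} (h : S.1.1 ⊆ T.1.1)
    (i : {i : Fin n // i ∈ S.1.1}) : p T ⟨i.1, h i.2⟩ ≤ p S i := by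
  by_contra! hlt
  have hrST : r T < r S := (hr (h i.2) i.2).1 hlt
  have hle (j : {j : Fin n // j ∈ S.1.1}) : p S j ≤ p T ⟨j.1, h j.2⟩ :=
    not_lt.1 fun hj => hrST.asymm ((hr j.2 (h j.2)).1 hj)
  have hsum : ∑ j, p S j < ∑ j, p T j :=
    (Finset.sum_lt_sum (fun j _ => hle j) ⟨i, Finset.mem_univ _, hlt⟩).trans_le
      (sum_comp_inclusion_le h (hp T).1)
  rw [(hp S).2, (hp T).2] at hsum
  exact lt_irrefl _ hsum

theorem mdmSet_subset_regSet (𝒮 : Set (Assortment n)) : mdmSet 𝒮 ⊆ regSet 𝒮 := by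
  intro p hp
  have hsimplex := mem_stdSimplex_of_mem_mdmSet hp
  obtain ⟨r, hr⟩ := exists_isLevelFunction_of_mem_mdmSet hp
  exact ⟨fun S => (hsimplex S).1, fun S => (hsimplex S).2, fun S T => hr.le_of_subset hsimplex⟩

theorem isLevelFunction_of_strictAnti
    (hlt : ∀ ⦃S T : 𝒮⦄ ⦃i : Fin n⦄ (hS : i ∈ S.1.1) (hT : i ∈ T.1.1), r S < r T →
      p T ⟨i, hT⟩ < p S ⟨i, hS⟩)
    (heq : ∀ ⦃S T : 𝒮⦄ ⦃i : Fin n⦄ (hS : i ∈ S.1.1) (hT : i ∈ T.1.1), r S = r T →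
      p S ⟨i, hS⟩ = p T ⟨i, hT⟩) : IsLevelFunction p r := by
  intro S T i hS hT
  rcases lt_trichotomy (r S) (r T) with h | h | h
  · exact ⟨fun _ => h, fun h' => absurd h' (hlt hS hT h).ne'⟩
  · exact ⟨fun h' => absurd (heq hS hT h) h'.ne', fun _ _ => h⟩
  · exact ⟨fun h' => absurd h' (hlt hT hS h).asymm, fun h' => absurd h' (hlt hT hS h).ne⟩

end LevelFunction

section StepLaw

/-- The values at `0, 1, 2, …` of the tail function of a law on `(0, N]`, in the case in which this
function is strictly decreasing where it lies in `(0, 1)`. -/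
structure IsTailSequence (a : ℕ → ℝ) (N : ℕ) : Prop where
  zero : a 0 = 1
  eq_zero : ∀ k, N ≤ k → a k = 0
  antitone : Antitone a
  eq_zero_or_eq_one : ∀ k, a (k + 1) = a k → a k = 0 ∨ a k = 1

/-- The law on `(0, N]` with constant density `a k - a (k + 1)` on `(k, k + 1]`. -/
noncomputable def stepLaw (a : ℕ → ℝ) (N : ℕ) : Measure ℝ :=
  ∑ k ∈ Finset.range N, ENNReal.ofReal (a k - a (k + 1)) • volume.restrict (Ioc (k : ℝ) (k + 1))

variable {a : ℕ → ℝ} {N : ℕ}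

theorem stepLaw_apply {s : Set ℝ} (hs : MeasurableSet s) :
    stepLaw a N s = ∑ k ∈ Finset.range N,
      ENNReal.ofReal (a k - a (k + 1)) * volume (s ∩ Ioc (k : ℝ) (k + 1)) := by
  simp [stepLaw, Measure.finsetSum_apply, Measure.restrict_apply hs]

theorem stepLaw_absolutelyContinuous : stepLaw a N ≪ volume := by
  refine Measure.AbsolutelyContinuous.mk fun s hs h => ?_
  rw [stepLaw_apply hs]
  exact Finset.sum_eq_zero fun k _ => by rw [measure_mono_null inter_subset_left h, mul_zero]

theorem integrable_stepLaw {f : ℝ → ℝ} (hf : Continuous f) : Integrable f (stepLaw a N) :=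
  integrable_finsetSum_measure.2 fun _ _ => Integrable.smul_measure
    (hf.integrableOn_Icc.mono_set Ioc_subset_Icc_self) ENNReal.ofReal_ne_top

theorem volume_Ioi_inter_Ioc (m k : ℕ) :
    volume (Ioi (m : ℝ) ∩ Ioc (k : ℝ) (k + 1)) = if m ≤ k then 1 else 0 := by
  rw [inter_comm, Ioc_inter_Ioi, Real.volume_Ioc]
  split_ifs with h
  · rw [sup_of_le_left (Nat.cast_le.2 h), add_sub_cancel_left, ENNReal.ofReal_one]
  · have h' : (k : ℝ) + 1 ≤ m := by exact_mod_cast not_le.1 h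
    exact ENNReal.ofReal_of_nonpos (sub_nonpos.2 (h'.trans le_sup_right))

namespace IsTailSequence

variable (ha : IsTailSequence a N)
include ha

theorem stepLaw_Ioi (m : ℕ) : stepLaw a N (Ioi (m : ℝ)) = ENNReal.ofReal (a m) := by
  simp only [stepLaw_apply measurableSet_Ioi, volume_Ioi_inter_Ioc, mul_ite, mul_one, mul_zero]
  have hfilter : (Finset.range N).filter (m ≤ ·) = Finset.Ico m N := by
    ext k
    simp [and_comm]
  rw [← Finset.sum_filter, hfilter,
    ← ENNReal.ofReal_sum_of_nonneg fun k _ => sub_nonneg.2 (ha.antitone k.le_succ)]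
  rcases le_total m N with h | h
  · have htelescope := Finset.sum_Ico_sub (fun k => -a k) h
    simp only [neg_sub_neg, ha.eq_zero N le_rfl, sub_zero] at htelescope
    rw [htelescope]
  · rw [Finset.Ico_eq_empty_of_le h, Finset.sum_empty, ha.eq_zero m h]

theorem isProbabilityMeasure_stepLaw : IsProbabilityMeasure (stepLaw a N) := by
  have hIic : stepLaw a N (Iic 0) = 0 := by
    rw [stepLaw_apply measurableSet_Iic]
    refine Finset.sum_eq_zero fun k _ => ?_
    have hempty : Iic (0 : ℝ) ∩ Ioc (k : ℝ) (k + 1) = ∅ :=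
      eq_empty_of_forall_notMem fun x hx => (hx.2.1.trans_le hx.1).not_ge k.cast_nonneg
    rw [hempty, measure_empty, mul_zero]
  have hIoi : stepLaw a N (Ioi 0) = 1 := by
    rw [← Nat.cast_zero, ha.stepLaw_Ioi, ha.zero, ENNReal.ofReal_one]
  refine ⟨?_⟩
  rw [← measure_add_measure_compl (s := Iic (0 : ℝ)) measurableSet_Iic, compl_Iic, hIic, hIoi,
    zero_add]

theorem nonneg (k : ℕ) : 0 ≤ a k :=
  ha.eq_zero (max k N) (le_max_right k N) ▸ ha.antitone (le_max_left k N)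

theorem stepLaw_real_Ioi (m : ℕ) : (stepLaw a N).real (Ioi (m : ℝ)) = a m := by
  rw [measureReal_def, ha.stepLaw_Ioi, ENNReal.toReal_ofReal (ha.nonneg m)]

theorem stepLaw_Ioc_ne_zero {x y : ℝ} (hx : 0 ≤ x) (hxy : x < y)
    (hstep : a (⌊x⌋₊ + 1) < a ⌊x⌋₊) : stepLaw a N (Ioc x y) ≠ 0 := by
  have hfloor : ⌊x⌋₊ < N := by
    by_contra! h
    rw [ha.eq_zero _ h, ha.eq_zero _ (h.trans (Nat.le_succ _))] at hstep
    exact lt_irrefl _ hstep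
  rw [stepLaw_apply measurableSet_Ioc, Ne, Finset.sum_eq_zero_iff]
  intro h
  refine mul_ne_zero (by simpa using hstep) ?_ (h _ (Finset.mem_range.2 hfloor))
  rw [Ioc_inter_Ioc, Real.volume_Ioc, Ne, ENNReal.ofReal_eq_zero, sub_nonpos, not_le,
    sup_of_le_left (Nat.floor_le hx)]
  exact lt_min hxy (Nat.lt_floor_add_one x)

theorem isAdmissibleMarginal_stepLaw : IsAdmissibleMarginal (stepLaw a N) := by
  have hprob := ha.isProbabilityMeasure_stepLaw
  refine ⟨hprob, stepLaw_absolutelyContinuous, fun x hx y hy hxy => ?_,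
    integrable_stepLaw continuous_id⟩
  have hx0 : 0 ≤ x := by
    have h := support_subset_Ici_of_real_Ioi_eq_one ((ha.stepLaw_real_Ioi 0).trans ha.zero) hx
    rwa [Nat.cast_zero] at h
  refine (monotone_cdf _ hxy.le).lt_of_ne fun hcdf => ?_
  refine ha.stepLaw_Ioc_ne_zero hx0 hxy ((ha.antitone (Nat.le_succ _)).lt_of_ne fun hstep => ?_)
    ((cdf_eq_cdf_iff_measure_Ioc_eq_zero hxy.le).1 hcdf)
  -- On a plateau at `0` or at `1` one of `x` and `y` lies outside the support.
  rcases ha.eq_zero_or_eq_one _ hstep with h | h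
  · have hle := support_subset_Iic_of_real_Ioi_eq_zero ((ha.stepLaw_real_Ioi _).trans h) hy
    exact (hxy.trans_le hle).not_ge (Nat.floor_le hx0)
  · have hge := support_subset_Ici_of_real_Ioi_eq_one
      ((ha.stepLaw_real_Ioi _).trans (hstep.trans h)) hx
    exact (Nat.lt_floor_add_one x).not_ge (by exact_mod_cast hge)

end IsTailSequence

end StepLaw

section LevelFunctionSufficiency

theorem exists_pos_nat_rank {κ α : Type*} [Finite κ] [LinearOrder α] (r : κ → α) :
    ∃ s : κ → ℕ, (∀ x, 0 < s x) ∧ ∀ x y, s x < s y ↔ r x < r y := by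
  have := Fintype.ofFinite κ
  let lower (x : κ) : Finset κ := {z | r z ≤ r x}
  have hmem (z x : κ) : z ∈ lower x ↔ r z ≤ r x := by simp [lower]
  have hmono {x y : κ} (h : r x ≤ r y) : lower x ⊆ lower y := fun z hz =>
    (hmem z y).2 (((hmem z x).1 hz).trans h)
  refine ⟨fun x => (lower x).card, fun x => Finset.card_pos.2 ⟨x, (hmem x x).2 le_rfl⟩,
    fun x y => ⟨fun h => not_le.1 fun hle => h.not_ge (Finset.card_le_card (hmono hle)),
      fun h => Finset.card_lt_card ⟨hmono h.le, fun hsub => ?_⟩⟩⟩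
  exact h.not_ge ((hmem y x).1 (hsub ((hmem y y).2 le_rfl)))

theorem isTailSequence_min_one {f : ℕ → ℝ} {N : ℕ} (hnonneg : ∀ k, 0 ≤ f k)
    (hstep : ∀ k, f (k + 1) < f k ∨ f (k + 1) = 0) (hN : ∀ k, N ≤ k → f k = 0) :
    IsTailSequence (fun k => if k = 0 then 1 else min 1 (f k)) (N + 1) where
  zero := if_pos rfl
  eq_zero k hk := by
    rw [if_neg (Nat.ne_zero_of_lt hk), hN k (Nat.le_of_succ_le hk), min_eq_right zero_le_one]
  antitone := by
    refine antitone_nat_of_succ_le fun k => ?_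
    rw [if_neg k.succ_ne_zero]
    split_ifs
    · exact min_le_left _ _
    · exact min_le_min_left _ ((hstep k).elim le_of_lt fun h => h.trans_le (hnonneg k))
  eq_zero_or_eq_one k h := by
    rw [if_neg k.succ_ne_zero] at h
    split_ifs with hk
    · exact Or.inr rfl
    · rw [if_neg hk] at h
      rcases hstep k with hlt | h0
      · refine Or.inr (min_eq_left (not_lt.1 fun hf => ?_))
        rw [min_eq_right hf.le, min_eq_right (hlt.trans hf).le] at h
        exact hlt.ne h
      · exact Or.inl (by rw [← h, h0, min_eq_right zero_le_one])

variable {κ : Type*} {q : κ → ℝ} {s : κ → ℕ} {η : ℝ}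

theorem exists_pos_slope_le [Finite κ] (q : κ → ℝ) (s : κ → ℕ) :
    ∃ η > 0, ∀ x y, q y < q x → q y + η * ((s y : ℝ) - s x) ≤ q x := by
  have hsmall (x y : κ) : ∀ᶠ η in 𝓝[>] (0 : ℝ),
      q y < q x → q y + η * ((s y : ℝ) - s x) ≤ q x := by
    by_cases h : q y < q x
    · have hlim : Tendsto (fun η : ℝ => q y + η * ((s y : ℝ) - s x)) (𝓝[>] 0) (𝓝 (q y)) :=
        tendsto_nhdsWithin_of_tendsto_nhds (Continuous.tendsto' (by fun_prop) _ _ (by simp))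
      filter_upwards [hlim.eventually_lt_const h] with η hη _ using hη.le
    · exact Eventually.of_forall fun η h' => absurd h' h
  have hall := eventually_all.2 fun x => eventually_all.2 (hsmall x)
  exact (eventually_mem_nhdsWithin.and hall).exists

/-- The least function of `k` which vanishes or decreases with slope at least `η`, and which is at
least `q x` at `s x` whenever `q x` is positive. -/
noncomputable def slopeEnvelope (q : κ → ℝ) (s : κ → ℕ) (η : ℝ) (k : ℕ) : ℝ :=
  ⨆ x, if k ≤ s x ∧ 0 < q x then q x + η * ((s x : ℝ) - k) else 0

theorem le_slopeEnvelope [Finite κ] {x : κ} {k : ℕ} (hk : k ≤ s x) (hx : 0 < q x) :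
    q x + η * ((s x : ℝ) - k) ≤ slopeEnvelope q s η k := by
  have h := le_ciSup (finite_range fun y =>
    if k ≤ s y ∧ 0 < q y then q y + η * ((s y : ℝ) - k) else 0).bddAbove x
  rwa [if_pos ⟨hk, hx⟩] at h

theorem slopeEnvelope_nonneg (hη : 0 ≤ η) (k : ℕ) : 0 ≤ slopeEnvelope q s η k := by
  refine Real.iSup_nonneg fun x => ?_
  split_ifs with h
  · exact add_nonneg h.2.le (mul_nonneg hη (sub_nonneg.2 (Nat.cast_le.2 h.1)))
  · exact le_rfl

theorem slopeEnvelope_le {k : ℕ} {c : ℝ} (hc : 0 ≤ c)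
    (h : ∀ x, k ≤ s x → 0 < q x → q x + η * ((s x : ℝ) - k) ≤ c) : slopeEnvelope q s η k ≤ c := by
  refine Real.iSup_le (fun x => ?_) hc
  split_ifs with hx
  · exact h x hx.1 hx.2
  · exact hc

theorem slopeEnvelope_succ_lt_or_eq_zero [Finite κ] (hη : 0 < η) (k : ℕ) :
    slopeEnvelope q s η (k + 1) < slopeEnvelope q s η k ∨ slopeEnvelope q s η (k + 1) = 0 := by
  have hle : slopeEnvelope q s η (k + 1) ≤ max 0 (slopeEnvelope q s η k - η) := by
    refine slopeEnvelope_le (le_max_left _ _) fun x hk hx => le_max_of_le_right ?_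
    have h := le_slopeEnvelope (η := η) (Nat.le_of_succ_le hk) hx
    push_cast
    linarith
  rcases le_max_iff.1 hle with h | h
  · exact Or.inr (h.antisymm (slopeEnvelope_nonneg hη.le _))
  · exact Or.inl (h.trans_lt (sub_lt_self _ hη))

theorem min_one_slopeEnvelope [Finite κ] (hη : 0 < η) (hq : ∀ x, q x ∈ Icc 0 1)
    (hslope : ∀ x y, q y < q x → q y + η * ((s y : ℝ) - s x) ≤ q x)
    (hlt : ∀ x y, q y < q x → s x < s y) (heq : ∀ x y, q x = q y → q x ∈ Ioo 0 1 → s x = s y)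
    (x : κ) : min 1 (slopeEnvelope q s η (s x)) = q x := by
  have hge : q x ≤ slopeEnvelope q s η (s x) := by
    rcases (hq x).1.eq_or_lt with h | h
    · exact h ▸ slopeEnvelope_nonneg hη.le _
    · simpa using le_slopeEnvelope (η := η) (le_refl (s x)) h
  rcases (hq x).2.eq_or_lt with h1 | h1
  · rw [h1, min_eq_left (h1 ▸ hge)]
  · have hle : slopeEnvelope q s η (s x) ≤ q x := by
      refine slopeEnvelope_le (hq x).1 fun y hy hpos => ?_
      rcases lt_trichotomy (q y) (q x) with h | h | h
      · exact hslope x y h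
      · rw [heq y x h ⟨hpos, h ▸ h1⟩, sub_self, mul_zero, add_zero, h]
      · exact absurd (hlt y x h) hy.not_gt
    rw [hle.antisymm hge, min_eq_right h1.le]

theorem exists_isTailSequence [Finite κ] (hq : ∀ x, q x ∈ Icc 0 1) (hs : ∀ x, 0 < s x)
    (hlt : ∀ x y, q y < q x → s x < s y) (heq : ∀ x y, q x = q y → q x ∈ Ioo 0 1 → s x = s y) :
    ∃ (a : ℕ → ℝ) (N : ℕ), IsTailSequence a N ∧ ∀ x, a (s x) = q x := by
  obtain ⟨η, hη, hslope⟩ := exists_pos_slope_le q s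
  obtain ⟨M, hM⟩ := (finite_range s).bddAbove
  have hzero (k : ℕ) (hk : M + 1 ≤ k) : slopeEnvelope q s η k = 0 :=
    (slopeEnvelope_le le_rfl fun x hx => absurd (hx.trans (hM (mem_range_self x)))
      (Nat.not_le.2 hk)).antisymm (slopeEnvelope_nonneg hη.le k)
  refine ⟨_, _, isTailSequence_min_one (slopeEnvelope_nonneg hη.le)
    (slopeEnvelope_succ_lt_or_eq_zero hη) hzero, fun x => ?_⟩
  rw [if_neg (hs x).ne', min_one_slopeEnvelope hη hq hslope hlt heq x]

variable {n : ℕ} {𝒮 : Set (Assortment n)} {p : ChoiceData 𝒮} {α : Type*} [LinearOrder α] {r : 𝒮 → α}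

theorem mem_mdmSet_of_isLevelFunction (hr : IsLevelFunction p r)
    (hp : ∀ S : 𝒮, p S ∈ stdSimplex ℝ {i // i ∈ S.1.1}) : p ∈ mdmSet 𝒮 := by
  obtain ⟨s, hpos, hs⟩ := exists_pos_nat_rank r
  have hs_eq {S T : 𝒮} (h : r S = r T) : s S = s T :=
    le_antisymm (not_lt.1 fun h' => ((hs T S).1 h').ne' h)
      (not_lt.1 fun h' => ((hs S T).1 h').ne h)
  have htail (i : Fin n) : ∃ (a : ℕ → ℝ) (N : ℕ), IsTailSequence a N ∧
      ∀ S : {S : 𝒮 // i ∈ S.1.1}, a (s S.1) = p S.1 ⟨i, S.2⟩ :=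
    exists_isTailSequence (fun S => mem_Icc_of_mem_stdSimplex (hp S.1) ⟨i, S.2⟩)
      (fun S => hpos S.1) (fun S T h => (hs _ _).2 ((hr S.2 T.2).1 h))
      fun S T h h' => hs_eq ((hr S.2 T.2).2 h h')
  choose a N ha hap using htail
  refine mem_mdmSet_of_thresholds (ν := 0) (fun i => (ha i).isAdmissibleMarginal_stepLaw)
    (fun S => (hp S).2) (fun S => s S) fun S i => ?_
  rw [exceedanceProb, Pi.zero_apply, sub_zero, (ha i.1).stepLaw_real_Ioi, hap i.1 ⟨S, i.2⟩]

end LevelFunctionSufficiency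

section RandomUtility

variable {n : ℕ} {𝒮 : Set (Assortment n)} {p : ChoiceData 𝒮}

theorem sum_real_argmaxEvent_eq_one {ν : Fin n → ℝ} {θ : Measure (Fin n → ℝ)}
    [IsProbabilityMeasure θ] (htie : ∀ i j : Fin n, i ≠ j → θ {ε | ν i + ε i = ν j + ε j} = 0)
    (S : Assortment n) : ∑ i ∈ S.1, θ.real (argmaxEvent ν S i) = 1 := by
  have hne : ∀ᵐ ε ∂θ, ∀ i j : Fin n, i ≠ j → ν i + ε i ≠ ν j + ε j :=
    ae_all_iff.2 fun i => ae_all_iff.2 fun j => ae_all_iff.2 fun hij =>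
      measure_eq_zero_iff_ae_notMem.1 (htie i j hij)
  have hmeas (i : Fin n) (_ : i ∈ S.1) := measurableSet_argmaxEvent ν S i
  rw [← measureReal_biUnion_finset (pairwiseDisjoint_argmaxEvent ν S _) hmeas, measureReal_def,
    ENNReal.toReal_eq_one_iff, ← mem_ae_iff_prob_eq_one (Finset.measurableSet_biUnion _ hmeas)]
  filter_upwards [hne] with ε hε
  obtain ⟨i, hi, hmax⟩ := S.1.exists_max_image (fun i => ν i + ε i) S.2
  exact mem_biUnion hi ⟨hi, fun j hj hji => (hmax j hj).lt_of_ne (hε j i hji)⟩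

theorem rumSet_subset_regSet (𝒮 : Set (Assortment n)) : rumSet 𝒮 ⊆ regSet 𝒮 := by
  rintro p ⟨ν, θ, hθ, htie, hp⟩
  refine ⟨fun S i => (hp S i).symm ▸ measureReal_nonneg, fun S => ?_, fun S T h i => ?_⟩
  · rw [← sum_real_argmaxEvent_eq_one htie S.1, ← Finset.sum_coe_sort S.1.1]
    exact Finset.sum_congr rfl fun i _ => hp S i
  · rw [hp, hp]
    exact measureReal_mono fun ε hε => ⟨i.2, fun j hj => hε.2 j (h hj)⟩

theorem mem_rumSet_of_extension {q : ChoiceData (univ : Set (Assortment n))}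
    (hq : q ∈ rumSet univ) (h : ∀ S i, p S i = q ⟨S.1, mem_univ _⟩ i) : p ∈ rumSet 𝒮 := by
  obtain ⟨ν, θ, hθ, htie, hqθ⟩ := hq
  exact ⟨ν, θ, hθ, htie, fun S i => by rw [h, hqθ]⟩

theorem add_le_add_of_mem_rumSet (hp : p ∈ rumSet 𝒮) {S T T' U : 𝒮} (hST : S.1.1 ⊆ T.1.1)
    (hST' : S.1.1 ⊆ T'.1.1) (hU : U.1.1 ⊆ T.1.1 ∪ T'.1.1) {i : Fin n} (hS : i ∈ S.1.1)
    (hT : i ∈ T.1.1) (hT' : i ∈ T'.1.1) (hiU : i ∈ U.1.1) :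
    p T ⟨i, hT⟩ + p T' ⟨i, hT'⟩ ≤ p S ⟨i, hS⟩ + p U ⟨i, hiU⟩ := by
  obtain ⟨ν, θ, hθ, -, h⟩ := hp
  simp only [h]
  rw [← measureReal_union_add_inter (measurableSet_argmaxEvent ν T'.1 i)]
  refine add_le_add (measureReal_mono ?_) (measureReal_mono ?_)
  · rintro ε (hε | hε)
    · exact ⟨hS, fun j hj => hε.2 j (hST hj)⟩
    · exact ⟨hS, fun j hj => hε.2 j (hST' hj)⟩
  · rintro ε ⟨hε, hε'⟩
    exact ⟨hiU, fun j hj => (Finset.mem_union.1 (hU hj)).elim (hε.2 j) (hε'.2 j)⟩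

variable {Ω : Type*} [Fintype Ω] {w : Ω → ℝ}

/-- The law with finitely many atoms `u ω` of mass `w ω`. -/
noncomputable def atomicLaw (w : Ω → ℝ) (u : Ω → Fin n → ℝ) : Measure (Fin n → ℝ) :=
  ∑ ω, ENNReal.ofReal (w ω) • Measure.dirac (u ω)

open Classical in
theorem atomicLaw_apply (w : Ω → ℝ) (u : Ω → Fin n → ℝ) {s : Set (Fin n → ℝ)}
    (hs : MeasurableSet s) : atomicLaw w u s = ∑ ω with u ω ∈ s, ENNReal.ofReal (w ω) := by
  simp [atomicLaw, Measure.finsetSum_apply, Measure.dirac_apply' _ hs, indicator_apply,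
    Finset.sum_filter]

open Classical in
theorem atomicLaw_real_apply (hw : ∀ ω, 0 ≤ w ω) (u : Ω → Fin n → ℝ) {s : Set (Fin n → ℝ)}
    (hs : MeasurableSet s) : (atomicLaw w u).real s = ∑ ω with u ω ∈ s, w ω := by
  rw [measureReal_def, atomicLaw_apply w u hs, ← ENNReal.ofReal_sum_of_nonneg fun ω _ => hw ω,
    ENNReal.toReal_ofReal (Finset.sum_nonneg fun ω _ => hw ω)]

open Classical in
theorem mem_rumSet_of_rankings {α : Type*} [LinearOrder α] (hw : w ∈ stdSimplex ℝ Ω)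
    (r : Ω → Fin n → α) (hr : ∀ ω, w ω ≠ 0 → Function.Injective (r ω))
    (hp : ∀ S i, p S i = ∑ ω with ∀ j ∈ S.1.1, j ≠ i.1 → r ω j < r ω i.1, w ω) :
    p ∈ rumSet 𝒮 := by
  choose s _ hs using fun ω => exists_pos_nat_rank (r ω)
  have hs_inj {ω : Ω} (hω : w ω ≠ 0) : Function.Injective (s ω) := fun i j hij =>
    hr ω hω (le_antisymm (not_lt.1 fun h => ((hs ω j i).2 h).ne' hij)
      (not_lt.1 fun h => ((hs ω i j).2 h).ne hij))
  refine ⟨0, atomicLaw w fun ω i => (s ω i : ℝ), ⟨?_⟩, fun i j hij => ?_, fun S i => ?_⟩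
  · rw [atomicLaw_apply _ _ MeasurableSet.univ]
    simp [← ENNReal.ofReal_sum_of_nonneg fun ω _ => hw.1 ω, hw.2]
  · rw [atomicLaw_apply _ _ (measurableSet_eq_fun (by fun_prop) (by fun_prop))]
    refine Finset.sum_eq_zero fun ω hω => ENNReal.ofReal_eq_zero.2 (le_of_eq ?_)
    by_contra h0
    exact (hs_inj h0).ne hij (by simpa using hω)
  · rw [hp, atomicLaw_real_apply hw.1 _ (measurableSet_argmaxEvent _ _ _)]
    simp [argmaxEvent, hs]

end RandomUtility

section Laminar

theorem exists_mem_stdSimplex_smul_eq {ι : Type*} [Fintype ι] [Nonempty ι] {g : ι → ℝ}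
    (hg : ∀ i, 0 ≤ g i) : ∃ ρ ∈ stdSimplex ℝ ι, (∑ i, g i) • ρ = g := by
  classical
  by_cases h : ∑ i, g i = 0
  · have hzero : g = 0 := funext fun i =>
      (Finset.sum_eq_zero_iff_of_nonneg fun i _ => hg i).1 h i (Finset.mem_univ i)
    exact ⟨_, single_mem_stdSimplex ℝ (Classical.arbitrary ι), by rw [h, zero_smul, hzero]⟩
  · refine ⟨(∑ i, g i)⁻¹ • g, ⟨fun i => ?_, ?_⟩, smul_inv_smul₀ h g⟩
    · exact mul_nonneg (inv_nonneg.2 (Finset.sum_nonneg fun i _ => hg i)) (hg i)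
    · simp only [Pi.smul_apply, smul_eq_mul]
      rw [← Finset.mul_sum, inv_mul_cancel₀ h]

/-- A partially defined random variable with subprobabilities bounded by `q` is completed to one
with law `q` by an independent draw where it is undefined. -/
theorem exists_completion_law {Ω ι : Type*} [Fintype Ω] [Fintype ι] [DecidableEq ι] [Nonempty ι]
    {w : Ω → ℝ} (hw : w ∈ stdSimplex ℝ Ω) {q : ι → ℝ} (hq : ∑ i, q i = 1) (X : Ω → Option ι)
    (h : ∀ i, ∑ ω with X ω = some i, w ω ≤ q i) :
    ∃ ρ ∈ stdSimplex ℝ ι,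
      ∀ i, ∑ x : Ω × ι with (X x.1).getD x.2 = i, w x.1 * ρ x.2 = q i := by
  obtain ⟨ρ, hρ, hsmul⟩ := exists_mem_stdSimplex_smul_eq fun i => sub_nonneg.2 (h i)
  have hnone : ∑ ω with X ω = none, w ω = ∑ i, (q i - ∑ ω with X ω = some i, w ω) := by
    rw [Finset.sum_sub_distrib, hq, ← hw.2, ← Finset.sum_fiberwise Finset.univ X w,
      Fintype.sum_option, add_sub_cancel_right]
  have hfiber (ω : Ω) (i : ι) : ∑ k with (X ω).getD k = i, w ω * ρ k =
      (if X ω = some i then w ω else 0) + (if X ω = none then w ω else 0) * ρ i := by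
    cases hX : X ω with
    | none => simp [Finset.filter_eq']
    | some j =>
      by_cases hij : j = i
      · simp [hij, ← Finset.mul_sum, hρ.2]
      · simp [hij]
  refine ⟨ρ, hρ, fun i => ?_⟩
  have hi := congrFun hsmul i
  rw [Pi.smul_apply, smul_eq_mul, ← hnone] at hi
  rw [Finset.sum_filter, Fintype.sum_prod_type]
  simp only [← Finset.sum_filter, hfiber, Finset.sum_add_distrib, ← Finset.sum_mul]
  rw [hi, add_sub_cancel]

variable {n : ℕ} {A : Set (Assortment n)}

theorem IsNested.isLaminar (h : IsNested A) : IsLaminar A :=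
  fun S hS T hT => (h S hS T hT).imp_right Or.inl

theorem IsLaminar.subset_of_card_le (hlam : IsLaminar A) {S T : Assortment n} (hS : S ∈ A)
    (hT : T ∈ A) {i : Fin n} (hiS : i ∈ S.1) (hiT : i ∈ T.1) (hcard : S.1.card ≤ T.1.card) :
    S.1 ⊆ T.1 := by
  rcases hlam S hS T hT with h | h | h
  · exact h
  · exact (Finset.eq_of_subset_of_card_le h hcard).ge
  · exact absurd hiT (Finset.disjoint_left.1 h hiS)

/-- A rule which chooses a product from each assortment. -/
abbrev ChoiceFunction (n : ℕ) : Type := (S : Assortment n) → {i : Fin n // i ∈ S.1}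

/-- Sen's property α on the collection `A`: the product chosen from a larger assortment is also
chosen from a smaller one which contains it. -/
def IsContractionConsistent (A : Set (Assortment n)) (c : ChoiceFunction n) : Prop :=
  ∀ S ∈ A, ∀ T ∈ A, S.1 ⊆ T.1 → (c T).1 ∈ S.1 → (c S).1 = (c T).1

variable {c : ChoiceFunction n} {a : Assortment n}

theorem IsContractionConsistent.exists_ranking (hc : IsContractionConsistent A c)
    (hlam : IsLaminar A) : ∃ r : Fin n → ℕ ×ₗ Fin n, Function.Injective r ∧
      ∀ S ∈ A, ∀ j ∈ S.1, j ≠ (c S).1 → r j < r (c S).1 := by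
  classical
  -- Rank a product by the size of the largest assortment from which it is chosen.
  let h (i : Fin n) : ℕ := (A.toFinite.toFinset.filter fun S => (c S).1 = i).sup fun S => S.1.card
  refine ⟨fun i => toLex (h i, i), fun i j hij => congrArg (fun x => (ofLex x).2) hij,
    fun S hS j hj hjc => Prod.Lex.left _ _ ?_⟩
  have hle : S.1.card ≤ h (c S).1 :=
    Finset.le_sup (f := fun S : Assortment n => S.1.card) (by simpa using hS)
  refine ((Finset.sup_lt_iff S.2.card_pos).2 fun T hT => ?_).trans_le hle
  obtain ⟨hTA, rfl⟩ : T ∈ A ∧ (c T).1 = j := by simpa using hT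
  by_contra! hcard
  exact hjc (hc S hS T hTA (hlam.subset_of_card_le hS hTA hj (c T).2 hcard) hj).symm

theorem IsContractionConsistent.update (hc : IsContractionConsistent A c)
    (hmin : ∀ T ∈ A, ¬ T.1 ⊆ a.1) (x : {i : Fin n // i ∈ a.1})
    (hx : ∀ T ∈ A, a.1 ⊆ T.1 → (c T).1 ∈ a.1 → x.1 = (c T).1) :
    IsContractionConsistent (insert a A) (Function.update c a x) := by
  have hne {T : Assortment n} (hT : T ∈ A) : T ≠ a := fun h => hmin T hT (h ▸ subset_rfl)
  rintro S (rfl | hS) T (rfl | hT) hST hcT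
  · rfl
  · rw [Function.update_of_ne (hne hT)] at hcT ⊢
    rw [Function.update_self]
    exact hx T hT hST hcT
  · exact absurd hST (hmin S hS)
  · rw [Function.update_of_ne (hne hT)] at hcT ⊢
    rw [Function.update_of_ne (hne hS)]
    exact hc S hS T hT hST hcT

theorem IsLaminar.exists_least_superset (hlam : IsLaminar A) (h : ∃ T ∈ A, a.1 ⊆ T.1) :
    ∃ T₀ ∈ A, a.1 ⊆ T₀.1 ∧ ∀ T ∈ A, a.1 ⊆ T.1 → T₀.1 ⊆ T.1 := by
  obtain ⟨T₀, ⟨hT₀, ha⟩, hmin⟩ := exists_min_image {T | T ∈ A ∧ a.1 ⊆ T.1} (fun T => T.1.card)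
    (toFinite _) h
  obtain ⟨i, hi⟩ := a.2
  exact ⟨T₀, hT₀, ha, fun T hT haT =>
    hlam.subset_of_card_le hT₀ hT (ha hi) (haT hi) (hmin T ⟨hT, haT⟩)⟩

/-- The choice probabilities `p` on the collection `A` are those of a random choice function which
is contraction consistent. -/
def IsConsistentMixture (A : Set (Assortment n)) (p : (S : Assortment n) → {i // i ∈ S.1} → ℝ) :
    Prop :=
  ∃ (Ω : Type) (_ : Fintype Ω) (w : Ω → ℝ) (c : Ω → ChoiceFunction n), w ∈ stdSimplex ℝ Ω ∧
    (∀ ω, IsContractionConsistent A (c ω)) ∧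
    ∀ S ∈ A, ∀ i, p S i = ∑ ω with c ω S = i, w ω

variable {p : (S : Assortment n) → {i // i ∈ S.1} → ℝ}

theorem IsLaminar.exists_inherited_choice {Ω : Type*} [Fintype Ω] {w : Ω → ℝ}
    {c : Ω → ChoiceFunction n} (hlam : IsLaminar A) (hc : ∀ ω, IsContractionConsistent A (c ω))
    (hp : ∀ S ∈ A, ∀ i, p S i = ∑ ω with c ω S = i, w ω) (ha : ∀ i, 0 ≤ p a i)
    (hreg : ∀ T ∈ A, ∀ h : a.1 ⊆ T.1, ∀ i, p T ⟨i.1, h i.2⟩ ≤ p a i) :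
    ∃ X : Ω → Option {i // i ∈ a.1}, (∀ i, ∑ ω with X ω = some i, w ω ≤ p a i) ∧
      ∀ ω, ∀ T ∈ A, a.1 ⊆ T.1 → ∀ h : (c ω T).1 ∈ a.1, X ω = some ⟨(c ω T).1, h⟩ := by
  by_cases hsup : ∃ T ∈ A, a.1 ⊆ T.1
  · obtain ⟨T₀, hT₀, haT₀, hleast⟩ := hlam.exists_least_superset hsup
    refine ⟨fun ω => if h : (c ω T₀).1 ∈ a.1 then some ⟨_, h⟩ else none, fun i => ?_,
      fun ω T hT haT h => ?_⟩
    · have hiff (ω : Ω) : (if h : (c ω T₀).1 ∈ a.1 then some ⟨_, h⟩ else none) = some i ↔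
          c ω T₀ = ⟨i.1, haT₀ i.2⟩ := by
        rw [Option.dite_none_right_eq_some, Subtype.ext_iff]
        exact ⟨fun ⟨_, h⟩ => congrArg (·.1) (Option.some_injective {i // i ∈ a.1} h),
          fun h => ⟨h ▸ i.2, congrArg some (Subtype.ext h)⟩⟩
      simp only [hiff, ← hp T₀ hT₀, hreg T₀ hT₀ haT₀ i]
    · have heq : (c ω T₀).1 = (c ω T).1 := hc ω T₀ hT₀ T hT (hleast T hT haT) (haT₀ h)
      exact (dif_pos (heq ▸ h)).trans (congrArg some (Subtype.ext heq))
  · exact ⟨fun _ => none, by simpa using ha, fun ω T hT haT => absurd ⟨T, hT, haT⟩ hsup⟩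

theorem IsConsistentMixture.insert (h : IsConsistentMixture A p) (hlam : IsLaminar A)
    (ha : p a ∈ stdSimplex ℝ {i // i ∈ a.1}) (hmin : ∀ T ∈ A, ¬ T.1 ⊆ a.1)
    (hreg : ∀ T ∈ A, ∀ h : a.1 ⊆ T.1, ∀ i, p T ⟨i.1, h i.2⟩ ≤ p a i) :
    IsConsistentMixture (insert a A) p := by
  obtain ⟨Ω, _, w, c, hw, hc, hp⟩ := h
  obtain ⟨X, hX, hXc⟩ := hlam.exists_inherited_choice hc hp ha.1 hreg
  have : Nonempty {i // i ∈ a.1} := a.2.to_subtype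
  obtain ⟨ρ, hρ, hXρ⟩ := exists_completion_law hw ha.2 X hX
  refine ⟨Ω × {i // i ∈ a.1}, inferInstance, fun x => w x.1 * ρ x.2,
    fun x => Function.update (c x.1) a ((X x.1).getD x.2),
    ⟨fun x => mul_nonneg (hw.1 _) (hρ.1 _), ?_⟩, fun x => ?_, ?_⟩
  · rw [Fintype.sum_prod_type]
    simp only [← Finset.mul_sum, hρ.2, mul_one, hw.2]
  · refine (hc x.1).update hmin _ fun T hT haT hcT => ?_
    rw [hXc x.1 T hT haT hcT, Option.getD_some]
  · rintro S (rfl | hS) i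
    · simp only [Function.update_self, hXρ]
    · have hne : S ≠ a := fun h => hmin S hS (h ▸ subset_rfl)
      simp only [Function.update_of_ne hne]
      rw [hp S hS, Finset.sum_filter, Finset.sum_filter, Fintype.sum_prod_type]
      refine Finset.sum_congr rfl fun ω _ => ?_
      split_ifs
      · simp only [← Finset.mul_sum, hρ.2, mul_one]
      · rw [Finset.sum_const_zero]

theorem isConsistentMixture_of_laminar (A : Finset (Assortment n))
    (hlam : IsLaminar (A : Set (Assortment n)))
    (hp : ∀ S ∈ A, p S ∈ stdSimplex ℝ {i // i ∈ S.1})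
    (hreg : ∀ S ∈ A, ∀ T ∈ A, ∀ h : S.1 ⊆ T.1, ∀ i, p T ⟨i.1, h i.2⟩ ≤ p S i) :
    IsConsistentMixture (A : Set (Assortment n)) p := by
  classical
  induction A using Finset.induction_on_min_value (f := fun S : Assortment n => S.1.card) with
  | empty => exact ⟨Unit, inferInstance, fun _ => 1, fun _ S => ⟨_, S.2.choose_spec⟩,
      ⟨by simp, by simp⟩, by simp [IsContractionConsistent], by simp⟩
  | insert a A ha hcard ih =>
    have hsub {S : Assortment n} (hS : S ∈ A) : S ∈ insert a A := Finset.mem_insert_of_mem hS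
    have hmin : ∀ T ∈ A, ¬ T.1 ⊆ a.1 := fun T hT h =>
      ha (Subtype.ext (Finset.eq_of_subset_of_card_le h (hcard T hT)) ▸ hT)
    have hlamA : IsLaminar (A : Set (Assortment n)) := fun S hS T hT =>
      hlam S (hsub hS) T (hsub hT)
    rw [Finset.coe_insert]
    exact (ih hlamA (fun S hS => hp S (hsub hS))
      (fun S hS T hT => hreg S (hsub hS) T (hsub hT))).insert hlamA
      (hp a (Finset.mem_insert_self a A)) hmin
      fun T hT => hreg a (Finset.mem_insert_self a A) T (hsub hT)

theorem forall_lt_iff_eq_of_forall_lt {β α : Type*} [Preorder α] {r : β → α} {S : Finset β}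
    {m : β} (hm : m ∈ S) (hmax : ∀ j ∈ S, j ≠ m → r j < r m) {i : β} (hi : i ∈ S) :
    (∀ j ∈ S, j ≠ i → r j < r i) ↔ m = i := by
  refine ⟨fun h => ?_, fun h => h ▸ hmax⟩
  by_contra hne
  exact (h m hm hne).asymm (hmax i hi (Ne.symm hne))

theorem IsLaminar.regSet_subset_rumSet {𝒮 : Set (Assortment n)} (hlam : IsLaminar 𝒮) :
    regSet 𝒮 ⊆ rumSet 𝒮 := by
  classical
  rintro p ⟨hnonneg, hsum, hreg⟩
  let q (S : Assortment n) : {i // i ∈ S.1} → ℝ := if h : S ∈ 𝒮 then p ⟨S, h⟩ else 0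
  have hq (S : 𝒮) : q S.1 = p S := dif_pos S.2
  obtain ⟨Ω, _, w, c, hw, hc, hqc⟩ := isConsistentMixture_of_laminar (p := q) 𝒮.toFinset
    (by simpa using hlam)
    (fun S hS => hq ⟨S, mem_toFinset.1 hS⟩ ▸ ⟨hnonneg ⟨S, _⟩, hsum ⟨S, _⟩⟩)
    (fun S hS T hT h i => by
      rw [hq ⟨S, mem_toFinset.1 hS⟩, hq ⟨T, mem_toFinset.1 hT⟩]
      exact hreg ⟨S, _⟩ ⟨T, _⟩ h i)
  rw [coe_toFinset] at hc hqc
  choose r hr hmax using fun ω => (hc ω).exists_ranking hlam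
  refine mem_rumSet_of_rankings hw r (fun ω _ => hr ω) fun S i => ?_
  rw [← hq, hqc S.1 S.2 i]
  simp only [forall_lt_iff_eq_of_forall_lt (c _ S.1).2 (hmax _ S.1 S.2) i.2, Subtype.ext_iff]

theorem IsLaminar.rumSet_eq_regSet {𝒮 : Set (Assortment n)} (hlam : IsLaminar 𝒮) :
    rumSet 𝒮 = regSet 𝒮 :=
  (rumSet_subset_regSet 𝒮).antisymm hlam.regSet_subset_rumSet

end Laminar

section Closure

variable {n : ℕ} {𝒮 : Set (Assortment n)}

theorem isClosed_regSet (𝒮 : Set (Assortment n)) : IsClosed (regSet 𝒮) := by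
  simp only [regSet, ofPred_and, ofPred_forall]
  refine (isClosed_iInter fun S => isClosed_iInter fun i =>
    isClosed_le continuous_const (by fun_prop)).inter
    ((isClosed_iInter fun S => isClosed_eq (by fun_prop) continuous_const).inter
      (isClosed_iInter fun S => isClosed_iInter fun T => isClosed_iInter fun h =>
        isClosed_iInter fun i => isClosed_le (by fun_prop) (by fun_prop)))

/-- The choice probabilities of a uniform choice from each assortment. -/
noncomputable def uniformData (𝒮 : Set (Assortment n)) : ChoiceData 𝒮 :=
  fun S _ => (S.1.1.card : ℝ)⁻¹

theorem uniformData_mem_stdSimplex (S : 𝒮) :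
    uniformData 𝒮 S ∈ stdSimplex ℝ {i // i ∈ S.1.1} := by
  refine ⟨fun i => inv_nonneg.2 (Nat.cast_nonneg _), ?_⟩
  simp [uniformData, S.1.2.ne_empty]

theorem IsLaminar.mix_uniformData_mem_mdmSet (hlam : IsLaminar 𝒮) {p : ChoiceData 𝒮}
    (hp : p ∈ regSet 𝒮) {ε : ℝ} (hε : ε ∈ Ioo 0 1) :
    (1 - ε) • p + ε • uniformData 𝒮 ∈ mdmSet 𝒮 := by
  have hε' : 0 < 1 - ε := sub_pos.2 hε.2
  refine mem_mdmSet_of_isLevelFunction (r := fun S => S.1.1.card)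
    (isLevelFunction_of_strictAnti (fun S T i hS hT hcard => ?_) fun S T i hS hT hcard => ?_)
    fun S => (convex_stdSimplex ℝ _) ⟨hp.1 S, hp.2.1 S⟩ (uniformData_mem_stdSimplex S)
      hε'.le hε.1.le (sub_add_cancel 1 ε)
  · have hST : S.1.1 ⊆ T.1.1 := hlam.subset_of_card_le S.2 T.2 hS hT hcard.le
    have hinv : (T.1.1.card : ℝ)⁻¹ < (S.1.1.card : ℝ)⁻¹ :=
      inv_strictAnti₀ (Nat.cast_pos.2 S.1.2.card_pos) (Nat.cast_lt.2 hcard)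
    exact add_lt_add_of_le_of_lt (mul_le_mul_of_nonneg_left (hp.2.2 S T hST ⟨i, hS⟩) hε'.le)
      (mul_lt_mul_of_pos_left hinv hε.1)
  · obtain rfl : S = T := Subtype.ext (Subtype.ext
      ((hlam.subset_of_card_le S.2 T.2 hS hT hcard.le).antisymm
        (hlam.subset_of_card_le T.2 S.2 hT hS hcard.ge)))
    rfl

theorem IsLaminar.regSet_subset_closure_mdmSet (hlam : IsLaminar 𝒮) :
    regSet 𝒮 ⊆ closure (mdmSet 𝒮) := by
  intro p hp
  have hlim : Tendsto (fun ε : ℝ => (1 - ε) • p + ε • uniformData 𝒮) (𝓝[>] 0) (𝓝 p) :=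
    tendsto_nhdsWithin_of_tendsto_nhds (Continuous.tendsto' (by fun_prop) _ _ (by simp))
  refine mem_closure_of_tendsto hlim ?_
  filter_upwards [Ioo_mem_nhdsGT (zero_lt_one' ℝ)] with ε hε
  exact hlam.mix_uniformData_mem_mdmSet hp hε

theorem IsLaminar.closure_mdmSet_eq_regSet (hlam : IsLaminar 𝒮) :
    closure (mdmSet 𝒮) = regSet 𝒮 :=
  (closure_minimal (mdmSet_subset_regSet 𝒮) (isClosed_regSet 𝒮)).antisymm
    hlam.regSet_subset_closure_mdmSet

end Closure

section TwoProducts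

theorem apply_eq_one_of_card_eq_one {ι : Type*} {s : Finset ι} {q : {i // i ∈ s} → ℝ}
    (hs : s.card = 1) (hq : ∑ i, q i = 1) (i : {i // i ∈ s}) : q i = 1 := by
  have : Subsingleton {i // i ∈ s} :=
    ⟨fun x y => Subtype.ext (Finset.card_le_one.1 hs.le _ x.2 _ y.2)⟩
  rwa [Fintype.sum_subsingleton _ i] at hq

theorem mem_mdmSet_of_subsingleton {n : ℕ} {𝒮 : Set (Assortment n)}
    (h𝒮 : {S ∈ 𝒮 | 1 < S.1.card}.Subsingleton) {p : ChoiceData 𝒮}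
    (hp : ∀ S : 𝒮, p S ∈ stdSimplex ℝ {i // i ∈ S.1.1}) : p ∈ mdmSet 𝒮 := by
  refine mem_mdmSet_of_isLevelFunction (r := fun S => S.1.1.card) (fun S T i hS hT => ?_) hp
  have hle : p S ⟨i, hS⟩ ≤ 1 := (mem_Icc_of_mem_stdSimplex (hp S) _).2
  rcases (Nat.succ_le_of_lt S.1.2.card_pos).eq_or_lt' with hS1 | hS1 <;>
    rcases (Nat.succ_le_of_lt T.1.2.card_pos).eq_or_lt' with hT1 | hT1
  · rw [apply_eq_one_of_card_eq_one hS1 (hp S).2, apply_eq_one_of_card_eq_one hT1 (hp T).2]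
    exact ⟨fun h => absurd h (lt_irrefl _), fun _ h => absurd h.2 (lt_irrefl _)⟩
  · rw [apply_eq_one_of_card_eq_one hS1 (hp S).2]
    exact ⟨fun _ => hS1.trans_lt hT1, fun _ h => absurd h.2 (lt_irrefl _)⟩
  · rw [apply_eq_one_of_card_eq_one hT1 (hp T).2]
    exact ⟨fun h => absurd h hle.not_gt, fun h h' => absurd h h'.2.ne⟩
  · obtain rfl : S = T := Subtype.ext (h𝒮 ⟨S.2, hS1⟩ ⟨T.2, hT1⟩)
    exact ⟨fun h => absurd h (lt_irrefl _), fun _ _ => rfl⟩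

theorem regSet_two_subset_mdmSet (𝒮 : Set (Assortment 2)) : regSet 𝒮 ⊆ mdmSet 𝒮 := by
  have huniv : ∀ S : Finset (Fin 2), 1 < S.card → S = Finset.univ := by decide
  exact fun p hp => mem_mdmSet_of_subsingleton
    (fun S hS T hT => Subtype.ext ((huniv _ hS.2).trans (huniv _ hT.2).symm))
    fun S => ⟨hp.1 S, hp.2.1 S⟩

theorem isLaminar_two (𝒮 : Set (Assortment 2)) : IsLaminar 𝒮 := by
  have h : ∀ S T : Finset (Fin 2), S ⊆ T ∨ T ⊆ S ∨ Disjoint S T := by decide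
  exact fun S _ T _ => h S.1 T.1

theorem rumSet_two_eq_mdmSet (𝒮 : Set (Assortment 2)) : rumSet 𝒮 = mdmSet 𝒮 := by
  rw [(isLaminar_two 𝒮).rumSet_eq_regSet]
  exact (regSet_two_subset_mdmSet 𝒮).antisymm (mdmSet_subset_regSet 𝒮)

end TwoProducts

section ThreeProducts

/-- The choice probabilities `p` as a function of arbitrary finsets, set to `0` off the pairs
`i ∈ S`, which saves the membership proofs in explicit computations. -/
noncomputable def totalProb {n : ℕ} (p : ChoiceData (univ : Set (Assortment n)))
    (S : Finset (Fin n)) (i : Fin n) : ℝ :=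
  if h : i ∈ S then p ⟨⟨S, ⟨i, h⟩⟩, mem_univ _⟩ ⟨i, h⟩ else 0

variable {n : ℕ} {p : ChoiceData (univ : Set (Assortment n))}

theorem totalProb_coe (S : (univ : Set (Assortment n))) (i : {i // i ∈ S.1.1}) :
    totalProb p S.1.1 i.1 = p S i :=
  dif_pos i.2

theorem sum_totalProb_eq_one (hp : p ∈ regSet univ) {S : Finset (Fin n)} (hS : S.Nonempty) :
    ∑ i ∈ S, totalProb p S i = 1 := by
  rw [← hp.2.1 ⟨⟨S, hS⟩, mem_univ _⟩, ← Finset.sum_coe_sort]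
  exact Finset.sum_congr rfl fun i _ => totalProb_coe ⟨⟨S, hS⟩, mem_univ _⟩ i

theorem totalProb_le_totalProb (hp : p ∈ regSet univ) {S T : Finset (Fin n)} (h : S ⊆ T)
    {i : Fin n} (hi : i ∈ S) : totalProb p T i ≤ totalProb p S i := by
  rw [totalProb, totalProb, dif_pos (h hi), dif_pos hi]
  exact hp.2.2 ⟨⟨S, ⟨i, hi⟩⟩, mem_univ _⟩ ⟨⟨T, ⟨i, h hi⟩⟩, mem_univ _⟩ h ⟨i, hi⟩

theorem totalProb_singleton (hp : p ∈ regSet univ) (i : Fin n) : totalProb p {i} i = 1 := by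
  rw [← sum_totalProb_eq_one hp (Finset.singleton_nonempty i), Finset.sum_singleton]

theorem totalProb_add_totalProb_pair_comm (hp : p ∈ regSet univ) {i j : Fin n} (h : i ≠ j) :
    totalProb p {i, j} i + totalProb p {j, i} j = 1 := by
  rw [← sum_totalProb_eq_one hp (Finset.insert_nonempty i {j}), Finset.sum_pair h,
    Finset.pair_comm j i]

theorem regSet_three_subset_rumSet : regSet (univ : Set (Assortment 3)) ⊆ rumSet univ := by
  classical
  intro p hp
  set f := totalProb p with hf
  -- The six rankings, by their second and last products, with the Block–Marschak weights.
  let second : Fin 6 → Fin 3 := ![1, 2, 2, 0, 0, 1]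
  let last : Fin 6 → Fin 3 := ![2, 1, 0, 2, 1, 0]
  let w (ω : Fin 6) : ℝ := f {second ω, last ω} (second ω) - f Finset.univ (second ω)
  let r (ω : Fin 6) (i : Fin 3) : Fin 3 :=
    if i = last ω then 0 else if i = second ω then 1 else 2
  have h01 : f {0, 1} 0 + f {1, 0} 1 = 1 := totalProb_add_totalProb_pair_comm hp (by decide)
  have h02 : f {0, 2} 0 + f {2, 0} 2 = 1 := totalProb_add_totalProb_pair_comm hp (by decide)
  have h12 : f {1, 2} 1 + f {2, 1} 2 = 1 := totalProb_add_totalProb_pair_comm hp (by decide)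
  have huniv : f Finset.univ 0 + f Finset.univ 1 + f Finset.univ 2 = 1 := by
    rw [← sum_totalProb_eq_one hp Finset.univ_nonempty, Fin.sum_univ_three]
  have hcases : ∀ S : Finset (Fin 3), ∀ i ∈ S, S = {i} ∨ (∃ j, i ≠ j ∧ S = {i, j}) ∨
    S = Finset.univ := by decide
  refine mem_rumSet_of_rankings (w := w) ⟨fun ω => ?_, ?_⟩ r (fun ω _ => ?_) fun S i => ?_
  · exact sub_nonneg.2 (totalProb_le_totalProb hp (Finset.subset_univ _) (by simp))
  · simp only [w, second, last, Fin.sum_univ_six, Matrix.cons_val]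
    linarith
  · exact (by decide : ∀ ω, Function.Injective (r ω)) ω
  · rw [← totalProb_coe (p := p), ← hf, Finset.sum_filter]
    obtain ⟨⟨S, hS⟩, -⟩ := S
    obtain ⟨i, hi⟩ := i
    dsimp only at hi ⊢
    rcases hcases S i hi with rfl | ⟨j, hij, rfl⟩ | rfl
    · rw [hf, totalProb_singleton hp]
      simp [w, second, last, Fin.sum_univ_six]
      linarith
    · fin_cases i <;> fin_cases j <;>
        simp [w, r, second, last, Fin.sum_univ_six] at hij ⊢ <;> linarith
    · fin_cases i <;> simp [w, r, second, last, Fin.sum_univ_six, Fin.forall_fin_succ] <;> linarith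

theorem mdmSet_three_subset_rumSet (𝒮 : Set (Assortment 3)) : mdmSet 𝒮 ⊆ rumSet 𝒮 := by
  intro p hp
  obtain ⟨q, hq, hpq⟩ := exists_extension_of_mem_mdmSet hp
  exact mem_rumSet_of_extension (regSet_three_subset_rumSet (mdmSet_subset_regSet _ hq)) hpq

end ThreeProducts

section Comparison

variable {n : ℕ} {𝒮 : Set (Assortment n)}

theorem mdmSet_inter_rumSet_nonempty (𝒮 : Set (Assortment n)) :
    (mdmSet 𝒮 ∩ rumSet 𝒮).Nonempty := by
  let best (S : 𝒮) : {i // i ∈ S.1.1} := ⟨S.1.1.max' S.1.2, S.1.1.max'_mem _⟩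
  have hbest (S : 𝒮) : ∀ j ∈ S.1.1, j ≠ (best S).1 → j < (best S).1 := fun j hj hne =>
    (S.1.1.le_max' j hj).lt_of_ne hne
  let p : ChoiceData 𝒮 := fun S i => if (best S).1 = i then 1 else 0
  have hp (S : 𝒮) : p S = Pi.single (best S) 1 := by
    ext i
    simp only [p, Pi.single_apply, Subtype.ext_iff, eq_comm]
  refine ⟨p, mem_mdmSet_of_isLevelFunction (r := fun S => (best S).1)
    (fun S T i hS hT => ⟨fun hlt => ?_, fun _ hmem => ?_⟩)
    fun S => hp S ▸ single_mem_stdSimplex ℝ (best S), ?_⟩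
  · simp only [p] at hlt
    split_ifs at hlt with hiT hiS hiS
    · exact absurd hlt (lt_irrefl _)
    · exact absurd hlt (by norm_num)
    · exact hiS.trans_lt (hbest T i hT (Ne.symm hiT))
    · exact absurd hlt (lt_irrefl _)
  · simp only [p] at hmem
    split_ifs at hmem <;> simp at hmem
  · classical
    refine mem_rumSet_of_rankings (Ω := Unit) (w := fun _ => 1) ⟨by simp, by simp⟩
      (fun _ => id) (fun _ _ => Function.injective_id) fun S i => ?_
    rw [Finset.sum_filter, Fintype.sum_unique]
    exact if_congr (forall_lt_iff_eq_of_forall_lt (best S).2 (hbest S) i.2).symm rfl rfl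

theorem not_rumSet_subset_mdmSet {i j k : Fin n} (hij : i < j) (hjk : j < k) {S T : 𝒮}
    (hS : S.1.1 = {i, j}) (hT : T.1.1 = {i, j, k}) : ¬ rumSet 𝒮 ⊆ mdmSet 𝒮 := by
  classical
  intro h
  -- The equal mixture of a ranking and its reverse.
  let r (ω : Bool) : Fin n → Fin n := if ω then id else Fin.rev
  let p : ChoiceData 𝒮 := fun S l =>
    ∑ ω, if ∀ m ∈ S.1.1, m ≠ l.1 → r ω m < r ω l.1 then 1 / 2 else 0
  have hp : p ∈ rumSet 𝒮 := by
    refine mem_rumSet_of_rankings (w := fun _ => 1 / 2) ⟨fun _ => by norm_num, by norm_num⟩ r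
      (fun ω _ => ?_) fun S l => (Finset.sum_filter _ _).symm
    cases ω
    · exact Fin.rev_injective
    · exact Function.injective_id
  obtain ⟨ρ, hρ⟩ := exists_isLevelFunction_of_mem_mdmSet (h hp)
  have hik := hij.trans hjk
  have hiS : i ∈ S.1.1 := by simp [hS]
  have hjS : j ∈ S.1.1 := by simp [hS]
  have hiT : i ∈ T.1.1 := by simp [hT]
  have hjT : j ∈ T.1.1 := by simp [hT]
  have hpiS : p S ⟨i, hiS⟩ = 1 / 2 := by
    simp [p, r, hS, hij, hij.ne', hij.le]
  have hpiT : p T ⟨i, hiT⟩ = 1 / 2 := by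
    simp [p, r, hT, hij, hij.ne', hik, hik.ne', hik.le]
  have hpjS : p S ⟨j, hjS⟩ = 1 / 2 := by
    simp [p, r, hS, hij, hij.ne, hij.le]
  have hpjT : p T ⟨j, hjT⟩ = 0 := by
    simp [p, r, hT, hij.ne, hjk.ne', hjk.not_gt, hij.not_gt]
  have heq := (hρ hiS hiT).2 (hpiS.trans hpiT.symm) (by rw [hpiS]; norm_num)
  have hlt := (hρ hjS hjT).1 (by rw [hpjS, hpjT]; norm_num)
  exact hlt.ne heq

/-- The choice probabilities in which the product `a` is chosen from an assortment of size `k` with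
probability `g k`, and the other products share the rest equally. -/
noncomputable def equalShareData (𝒮 : Set (Assortment n)) (a : Fin n) (g : ℕ → ℝ) :
    ChoiceData 𝒮 :=
  fun S i => if i.1 = a then g S.1.1.card else (1 - g S.1.1.card) / (S.1.1.card - 1)

theorem equalShareData_mem_stdSimplex {a : Fin n} {g : ℕ → ℝ} {S : 𝒮} (ha : a ∈ S.1.1)
    (hcard : 1 < S.1.1.card) (hg : g S.1.1.card ∈ Icc 0 1) :
    equalShareData 𝒮 a g S ∈ stdSimplex ℝ {i // i ∈ S.1.1} := by
  have hpos : (0 : ℝ) < S.1.1.card - 1 := sub_pos.2 (Nat.one_lt_cast.2 hcard)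
  refine ⟨fun i => ?_, ?_⟩
  · rw [equalShareData]
    split_ifs
    · exact hg.1
    · exact div_nonneg (sub_nonneg.2 hg.2) hpos.le
  · have hrest : (S.1.1.filter (¬ · = a)).card = S.1.1.card - 1 := by
      rw [Finset.filter_ne', Finset.card_erase_of_mem ha]
    simp only [equalShareData]
    rw [Finset.sum_coe_sort S.1.1 fun i => if i = a then g S.1.1.card else
      (1 - g S.1.1.card) / (S.1.1.card - 1), Finset.sum_ite, Finset.filter_eq', if_pos ha,
      Finset.sum_singleton, Finset.sum_const, hrest, nsmul_eq_mul, Nat.cast_pred hcard.pos,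
      mul_div_cancel₀ _ hpos.ne', add_sub_cancel]

theorem equalShareData_mem_mdmSet {a : Fin n} {g : ℕ → ℝ} {K : Set ℕ}
    (h𝒮 : ∀ S ∈ 𝒮, a ∈ S.1 ∧ S.1.card ∈ K) (hK : ∀ k ∈ K, 1 < k) (hg : MapsTo g K (Icc 0 1))
    (hanti : StrictAntiOn g K) (hanti' : StrictAntiOn (fun k => (1 - g k) / (k - 1)) K) :
    equalShareData 𝒮 a g ∈ mdmSet 𝒮 := by
  have hcard (S : 𝒮) := (h𝒮 S.1 S.2).2
  refine mem_mdmSet_of_isLevelFunction (r := fun S => S.1.1.card)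
    (isLevelFunction_of_strictAnti (fun S T i hS hT h => ?_) fun S T i hS hT h => ?_)
    fun S => equalShareData_mem_stdSimplex (h𝒮 S.1 S.2).1 (hK _ (hcard S)) (hg (hcard S))
  · simp only [equalShareData]
    split_ifs
    · exact hanti (hcard S) (hcard T) h
    · exact hanti' (hcard S) (hcard T) h
  · simp only [equalShareData, h]

theorem not_mdmSet_subset_rumSet {S T T' U : Assortment n} (hST : S.1 ⊆ T.1) (hST' : S.1 ⊆ T'.1)
    (hTU : T.1 ⊆ U.1) (hU : U.1 ⊆ T.1 ∪ T'.1) (hS : S.1.card = 2) (hT : T.1.card = 3)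
    (hT' : T'.1.card = 3) (hU4 : U.1.card = 4) :
    ¬ mdmSet {S, T, T', U} ⊆ rumSet {S, T, T', U} := by
  intro h
  obtain ⟨a, ha⟩ := S.2
  -- A concave function of the size violates the supermodularity of random utility models.
  let g (k : ℕ) : ℝ := (24 - k ^ 2) / 30
  have hmem : equalShareData {S, T, T', U} a g ∈ mdmSet {S, T, T', U} := by
    refine equalShareData_mem_mdmSet (K := Icc 2 4) ?_ (fun k hk => hk.1) ?_ ?_ ?_
    · rintro _ (rfl | rfl | rfl | rfl)
      · exact ⟨ha, by simp [hS]⟩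
      · exact ⟨hST ha, by simp [hT]⟩
      · exact ⟨hST' ha, by simp [hT']⟩
      · exact ⟨hTU (hST ha), by simp [hU4]⟩
    · rintro k ⟨hk, hk'⟩
      interval_cases k <;> norm_num [g]
    · rintro k ⟨hk, hk'⟩ l ⟨hl, hl'⟩ hkl
      interval_cases k <;> interval_cases l <;> norm_num [g] at hkl ⊢
    · rintro k ⟨hk, hk'⟩ l ⟨hl, hl'⟩ hkl
      interval_cases k <;> interval_cases l <;> norm_num [g] at hkl ⊢
  have hineq := add_le_add_of_mem_rumSet (h hmem) (S := ⟨S, by simp⟩) (T := ⟨T, by simp⟩)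
    (T' := ⟨T', by simp⟩) (U := ⟨U, by simp⟩) hST hST' hU ha (hST ha) (hST' ha) (hTU (hST ha))
  simp only [equalShareData, if_true, hS, hT, hT', hU4] at hineq
  norm_num [g] at hineq

theorem exists_incomparable (hn : 4 ≤ n) : ∃ 𝒮 : Set (Assortment n),
    ¬ mdmSet 𝒮 ⊆ rumSet 𝒮 ∧ ¬ rumSet 𝒮 ⊆ mdmSet 𝒮 := by
  let e := Fin.castLEEmb hn
  let S (s : Finset (Fin 4)) (hs : s.Nonempty) : Assortment n := ⟨s.map e, hs.map⟩
  let 𝒮 : Set (Assortment n) := {S {0, 1} (by decide), S {0, 1, 2} (by decide),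
    S {0, 1, 3} (by decide), S {0, 1, 2, 3} (by decide)}
  refine ⟨𝒮, not_mdmSet_subset_rumSet ?_ ?_ ?_ ?_ ?_ ?_ ?_ ?_,
    not_rumSet_subset_mdmSet (𝒮 := 𝒮) (i := e 0) (j := e 1) (k := e 2)
      (S := ⟨_, Or.inl rfl⟩) (T := ⟨_, Or.inr (Or.inl rfl)⟩)
      ?_ ?_ ?_ ?_⟩
  · exact Finset.map_subset_map.2 (by decide)
  · exact Finset.map_subset_map.2 (by decide)
  · exact Finset.map_subset_map.2 (by decide)
  · rw [← Finset.map_union]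
    exact Finset.map_subset_map.2 (by decide)
  · exact Finset.card_map e
  · exact Finset.card_map e
  · exact Finset.card_map e
  · exact Finset.card_map e
  · exact Fin.castLE_lt_castLE_iff hn |>.2 (by decide)
  · exact Fin.castLE_lt_castLE_iff hn |>.2 (by decide)
  · simp [S, Finset.map_insert]
  · simp [S, Finset.map_insert]

end Comparison

end ChoiceModels

theorem theorem3 :
    -- two products: the two models represent the same choice probabilities
    (∀ 𝒮 : Set (ChoiceModels.Assortment 2),
      ChoiceModels.rumSet 𝒮 = ChoiceModels.mdmSet 𝒮) ∧
    -- three products: the first set is contained in the second, for some collections strictly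
    (∀ 𝒮 : Set (ChoiceModels.Assortment 3),
      ChoiceModels.mdmSet 𝒮 ⊆ ChoiceModels.rumSet 𝒮) ∧
    (∃ 𝒮 : Set (ChoiceModels.Assortment 3),
      ChoiceModels.mdmSet 𝒮 ⊂ ChoiceModels.rumSet 𝒮) ∧
    -- four or more products: the sets always meet, and for some collections neither contains
    -- the other
    (∀ n : ℕ, 4 ≤ n →
      (∀ 𝒮 : Set (ChoiceModels.Assortment n),
        (ChoiceModels.mdmSet 𝒮 ∩ ChoiceModels.rumSet 𝒮).Nonempty) ∧
      ∃ 𝒮 : Set (ChoiceModels.Assortment n),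
        ¬ ChoiceModels.mdmSet 𝒮 ⊆ ChoiceModels.rumSet 𝒮 ∧
        ¬ ChoiceModels.rumSet 𝒮 ⊆ ChoiceModels.mdmSet 𝒮) ∧
    -- nested or laminar collections, any number of products
    (∀ (n : ℕ) (𝒮 : Set (ChoiceModels.Assortment n)),
      ChoiceModels.IsNested 𝒮 ∨ ChoiceModels.IsLaminar 𝒮 →
        ChoiceModels.rumSet 𝒮 = closure (ChoiceModels.mdmSet 𝒮) ∧
        closure (ChoiceModels.mdmSet 𝒮) = ChoiceModels.regSet 𝒮) := by
  refine ⟨ChoiceModels.rumSet_two_eq_mdmSet, ChoiceModels.mdmSet_three_subset_rumSet,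
    ⟨Set.univ, ChoiceModels.mdmSet_three_subset_rumSet _, ?_⟩,
    fun n hn => ⟨ChoiceModels.mdmSet_inter_rumSet_nonempty, ChoiceModels.exists_incomparable hn⟩,
    fun n 𝒮 h => ?_⟩
  · exact ChoiceModels.not_rumSet_subset_mdmSet (i := 0) (j := 1) (k := 2) (by decide) (by decide)
      (S := ⟨⟨{0, 1}, by decide⟩, Set.mem_univ _⟩) (T := ⟨⟨{0, 1, 2}, by decide⟩, Set.mem_univ _⟩)
      rfl rfl
  · have hlam : ChoiceModels.IsLaminar 𝒮 := h.elim ChoiceModels.IsNested.isLaminar id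
    rw [hlam.closure_mdmSet_eq_regSet]
    exact ⟨hlam.rumSet_eq_regSet, rfl⟩
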